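/- Let $\psi\in\mathbb{C}^2\otimes\mathbb{C}^2$ with $\|\psi\|=1$. For a block $S\subseteq[n]$ of consecutive qubits of a chain of $n$ qubits, let $G_S$ be the orthogonal projector, acting on $(\mathbb{C}^2)^{\otimes n}$, onto the ground space (the eigenspace of the smallest eigenvalue) of the truncated Hamiltonian $\sum_{\{i,i+1\}\subseteq S}|\psi\rangle\langle\psi|_{i,i+1}$. Let $$T_\psi=\begin{pmatrix}\langle\psi|0,1\rangle & \langle\psi|1,1\rangle\\ -\langle\psi|0,0\rangle & -\langle\psi|1,0\rangle\end{pmatrix}.$$ Suppose that the eigenvalues $\mu_1,\mu_2$ of $T_\psi$ satisfy $|\mu_1|<|\mu_2|$, and let $c$ be the inner product between the corresponding normalized eigenvectors. Then there are constants $K_1,K_2$ depending only on $\psi$ such that the following holds for every $n$ and every partition $[n]=ABC$ into consecutive (possibly empty) blocks, ordered from left to right, with $|B|=r$ (and the convention $0^0=1$). If $\mu_1\ne 0$, then with $\lambda=\mu_2/\mu_1$, $$\|G_{ABC}-G_{AB}G_{BC}\|\le K_1\, r^{1/2}|\lambda|^{-r/8}+K_2\,|c|^{r/8}.$$ If $\mu_1=0$,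 then the first term is absent: $$\|G_{ABC}-G_{AB}G_{BC}\|\le K_2\,|c|^{r/8}.$$ Here $\|\cdot\|$ is the operator norm. -/

import Mathlib

open scoped Matrix

noncomputable section

/-- The state space `(ℂ²)^{⊗ n}` of a chain of `n` qubits, with orthonormal standard basis
indexed by binary strings. -/
abbrev Chain (n : ℕ) : Type := EuclideanSpace ℂ (Fin n → Fin 2)

/-- The state space `ℂ² ⊗ ℂ²` of two qubits; `ψ (a, b)` is the amplitude `⟨a,b|ψ⟩`. -/
abbrev TwoQubit : Type := EuclideanSpace ℂ (Fin 2 × Fin 2)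

/-- The `2 × 2` matrix `T_ψ`, where `⟨ψ|a,b⟩ = conj (ψ (a, b))`. -/
def tMatrix (ψ : TwoQubit) : Matrix (Fin 2) (Fin 2) ℂ :=
  !![star (ψ (0, 1)), star (ψ (1, 1)); -star (ψ (0, 0)), -star (ψ (1, 0))]

/-- The matrix, in the standard basis of `n` qubits, of the operator `|ψ⟩⟨ψ|_{i,j}`, which is
`|ψ⟩⟨ψ|` on the qubits `i, j` tensored with the identity on all the other qubits. -/
def pairProjector (ψ : TwoQubit) {n : ℕ} (i j : Fin n) :
    Matrix (Fin n → Fin 2) (Fin n → Fin 2) ℂ :=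
  Matrix.of fun x y =>
    if ∀ k, k ≠ i → k ≠ j → x k = y k then ψ (x i, x j) * star (ψ (y i, y j)) else 0

/-- The truncated Hamiltonian `∑_{{i,i+1} ⊆ S} |ψ⟩⟨ψ|_{i,i+1}` on `n` qubits. -/
def blockHamiltonian (ψ : TwoQubit) {n : ℕ} (S : Finset (Fin n)) : Chain n →ₗ[ℂ] Chain n :=
  Matrix.toEuclideanLin
    (∑ i : Fin n, ∑ j : Fin n,
      if i ∈ S ∧ j ∈ S ∧ (i : ℕ) + 1 = (j : ℕ) then pairProjector ψ i j else 0)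

/-- The ground energy of a Hamiltonian: its smallest (real) eigenvalue. -/
def groundEnergy {n : ℕ} (H : Chain n →ₗ[ℂ] Chain n) : ℝ :=
  sInf {E : ℝ | Module.End.HasEigenvalue H (E : ℂ)}

/-- The ground space of a Hamiltonian: the eigenspace of its smallest eigenvalue. -/
def groundSpace {n : ℕ} (H : Chain n →ₗ[ℂ] Chain n) : Submodule ℂ (Chain n) :=
  Module.End.eigenspace H (groundEnergy H : ℂ)

/-- `G_S`: the orthogonal projector onto the ground space of the truncated Hamiltonian. -/
def groundProjector (ψ : TwoQubit) {n : ℕ} (S : Finset (Fin n)) : Chain n →L[ℂ] Chain n :=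
  (groundSpace (blockHamiltonian ψ S)).starProjection

/-- The block of consecutive qubits at the positions `p, p + 1, …, q - 1` (counted from `0`). -/
def block (n p q : ℕ) : Finset (Fin n) :=
  Finset.univ.filter fun i => p ≤ (i : ℕ) ∧ (i : ℕ) < q

/-- For the chain of `a + r + b` qubits cut from left to right into blocks `A, B, C` of sizes
`a, r, b`: the operator norm of `G_{ABC} - G_{AB} G_{BC}`. -/
def projectorDefect (ψ : TwoQubit) (a r b : ℕ) : ℝ :=
  ‖groundProjector ψ (block (a + r + b) 0 (a + r + b)) -
    groundProjector ψ (block (a + r + b) 0 (a + r)) *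
      groundProjector ψ (block (a + r + b) a (a + r + b))‖

end

/-! Contracting a bond with ψ reads off, up to sign, the antisymmetric part of `T` applied at its
left site. So the ground space of an interval is `chainSpace`: on every bond, `T_i ξ` is invariant
under the exchange of the two sites. Two facts about qubits carry the argument: against
antisymmetric states, a matrix at one site acts as its adjugate at the other (`sub_swapOp_siteOp`),
and three qubits have no totally antisymmetric state (`sum_perm_three`). For invertible `T` the
bonds propagate: `T_i ^ m ξ` is invariant under the exchange of i and i+m (`swapOp_siteOp_pow`).

Let P and W project onto the eigenvectors of the larger eigenvalue ν and the smaller one μ, with ρ =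
|μ|/|ν|. On the chain space, `1 - W` at a site and `1 - P` at a site m steps to the right exclude
each other up to ρ^m (`norm_siteOp_compl_siteOp_compl_le`). Hence a state with `1 - P` at its right
end looks like W on a distant block to the left, and one with `1 - W` at its left end looks like P
on a distant block to the right.

By `norm_starProjection_sub_mul_le` it suffices to bound ⟨x, y⟩ for x, y in the ground spaces of two
intervals shifted by one site, both orthogonal to the ground space of their union. Split according
to P at the right end and W at the left end. Exclusion controls the complementary components. The
component of x with P at its free right end is controlled by orthogonality:
`re_inner_swapOp_le_norm_chainProj` bounds from below what survives a one-site extension, and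
dualizing it (`norm_apply_siteOp_le`) transfers the localization from the larger chain space to x.
The remaining product compares a state close to W with one close to P on n common sites and costs
c^n (`norm_inner_le_of_mem_chainSpace`). If μ = 0, `T` is singular and these steps are done
directly.

Reserving about a quarter of the overlap as buffer on each side gives exponential decay for one-site
extensions. Telescoping site by site gives arbitrary A and C, with rates ρ^(r/4) and c^(r/2),
stronger than those required. -/

noncomputable section

/-! ### One-site operators, exchanges and the algebra of antisymmetric states -/

section SiteOperators

variable {ι : Type} [Fintype ι] [DecidableEq ι]

/-- The state space of qubits indexed by `ι`. -/
abbrev QubitSpace (ι : Type) [Fintype ι] : Type := EuclideanSpace ℂ (ι → Fin 2)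

/-- The action of a `2 × 2` matrix on the qubit `l`, as a linear map. -/
def siteLin (l : ι) (M : Matrix (Fin 2) (Fin 2) ℂ) : QubitSpace ι →ₗ[ℂ] QubitSpace ι where
  toFun ξ := WithLp.toLp 2 fun x => ∑ b, M (x l) b * ξ (Function.update x l b)
  map_add' ξ η := by
    ext x
    simp only [PiLp.add_apply, mul_add, Finset.sum_add_distrib]
  map_smul' a ξ := by
    ext x
    simp only [PiLp.smul_apply, smul_eq_mul, RingHom.id_apply, Finset.mul_sum]
    exact Finset.sum_congr rfl fun b _ => by ring

theorem siteLin_apply (l : ι) (M : Matrix (Fin 2) (Fin 2) ℂ) (ξ : QubitSpace ι)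
    (x : ι → Fin 2) :
    siteLin l M ξ x = ∑ b, M (x l) b * ξ (Function.update x l b) := rfl

theorem siteLin_inner (l : ι) (M : Matrix (Fin 2) (Fin 2) ℂ) (ξ η : QubitSpace ι) :
    inner ℂ (siteLin l M ξ) η = inner ℂ ξ (siteLin l Mᴴ η) := by
  simp only [PiLp.inner_apply, siteLin_apply, RCLike.inner_apply, map_sum, map_mul,
    Finset.mul_sum, Finset.sum_mul, Matrix.conjTranspose_apply]
  rw [← Finset.sum_product', ← Finset.sum_product']
  refine Finset.sum_bij' (fun p _ => (Function.update p.1 l p.2, p.1 l))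
    (fun p _ => (Function.update p.1 l p.2, p.1 l)) (by simp) (by simp) (by simp) (by simp) ?_
  rintro ⟨x, b⟩ _
  simp
  ring

/-- The action of a `2 × 2` matrix on the qubit `l`, as a `*`-homomorphism. -/
def siteOp (l : ι) :
    Matrix (Fin 2) (Fin 2) ℂ →⋆ₐ[ℂ] (QubitSpace ι →L[ℂ] QubitSpace ι) where
  toFun M := LinearMap.toContinuousLinearMap (siteLin l M)
  map_one' := by
    ext ξ x
    simp [siteLin_apply, Matrix.one_apply]
  map_mul' M N := by
    ext ξ x
    simp [siteLin_apply, Matrix.mul_apply]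
    ring
  map_zero' := by
    ext ξ x
    simp [siteLin_apply]
  map_add' M N := by
    ext ξ x
    simp [siteLin_apply]
    ring
  commutes' r := by
    ext ξ x
    simp [siteLin_apply, Algebra.algebraMap_eq_smul_one, Matrix.one_apply]
  map_star' M := by
    rw [ContinuousLinearMap.star_eq_adjoint, ContinuousLinearMap.eq_adjoint_iff]
    intro ξ η
    have := siteLin_inner l Mᴴ ξ η
    rw [Matrix.conjTranspose_conjTranspose] at this
    exact this

theorem siteOp_apply (l : ι) (M : Matrix (Fin 2) (Fin 2) ℂ) (ξ : QubitSpace ι)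
    (x : ι → Fin 2) :
    siteOp l M ξ x = ∑ b, M (x l) b * ξ (Function.update x l b) := rfl

theorem siteOp_inner (l : ι) (M : Matrix (Fin 2) (Fin 2) ℂ) (ξ η : QubitSpace ι) :
    inner ℂ (siteOp l M ξ) η = inner ℂ ξ (siteOp l Mᴴ η) := siteLin_inner l M ξ η

theorem siteOp_commute {l k : ι} (h : l ≠ k) (M N : Matrix (Fin 2) (Fin 2) ℂ)
    (ξ : QubitSpace ι) : siteOp l M (siteOp k N ξ) = siteOp k N (siteOp l M ξ) := by
  ext x
  simp only [siteOp_apply, Fin.sum_univ_two, Function.update_of_ne h, Function.update_of_ne h.symm,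
    Function.update_comm h]
  ring

theorem siteOp_mul (l : ι) (M N : Matrix (Fin 2) (Fin 2) ℂ)
    (ξ : QubitSpace ι) : siteOp l M (siteOp l N ξ) = siteOp l (M * N) ξ := by
  rw [map_mul]; rfl

/-- The operator exchanging the qubits `i` and `j`. -/
def swapOp (i j : ι) : QubitSpace ι →L[ℂ] QubitSpace ι :=
  LinearMap.toContinuousLinearMap
    { toFun := fun ξ => WithLp.toLp 2 fun x => ξ (x ∘ Equiv.swap i j)
      map_add' := fun ξ η => by ext x; simp
      map_smul' := fun a ξ => by ext x; simp }

theorem swapOp_apply (i j : ι) (ξ : QubitSpace ι) (x : ι → Fin 2) :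
    swapOp i j ξ x = ξ (x ∘ Equiv.swap i j) := rfl

theorem swapOp_comm (i j : ι) : (swapOp i j : QubitSpace ι →L[ℂ] QubitSpace ι) = swapOp j i := by
  ext ξ x
  rw [swapOp_apply, swapOp_apply, Equiv.swap_comm]

theorem swapOp_swapOp (i j : ι) (ξ : QubitSpace ι) : swapOp i j (swapOp i j ξ) = ξ := by
  ext x
  rw [swapOp_apply, swapOp_apply]
  exact congrArg ξ.ofLp (funext fun l => by simp)

theorem swapOp_inner (i j : ι) (ξ η : QubitSpace ι) :
    inner ℂ (swapOp i j ξ) η = inner ℂ ξ (swapOp i j η) := by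
  simp only [PiLp.inner_apply, swapOp_apply]
  refine Finset.sum_bij' (fun x _ => x ∘ Equiv.swap i j) (fun x _ => x ∘ Equiv.swap i j)
    (by simp) (by simp) ?_ ?_ ?_ <;> intro x _ <;>
    simp [Function.comp_assoc, ← Equiv.coe_trans]

theorem norm_swapOp (i j : ι) (ξ : QubitSpace ι) : ‖swapOp i j ξ‖ = ‖ξ‖ := by
  rw [@norm_eq_sqrt_re_inner ℂ, @norm_eq_sqrt_re_inner ℂ, swapOp_inner, swapOp_swapOp]

theorem swapOp_siteOp_left {i j : ι} (M : Matrix (Fin 2) (Fin 2) ℂ) (ξ : QubitSpace ι) :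
    swapOp i j (siteOp i M ξ) = siteOp j M (swapOp i j ξ) := by
  ext x
  simp only [swapOp_apply, siteOp_apply, Function.comp_apply, Equiv.swap_apply_left]
  refine Finset.sum_congr rfl fun b _ => ?_
  rw [Function.update_comp_equiv, Equiv.symm_swap, Equiv.swap_apply_right]

theorem swapOp_siteOp_right {i j : ι} (M : Matrix (Fin 2) (Fin 2) ℂ) (ξ : QubitSpace ι) :
    swapOp i j (siteOp j M ξ) = siteOp i M (swapOp i j ξ) := by
  rw [swapOp_comm, swapOp_siteOp_left]

theorem swapOp_siteOp_of_ne {i j k : ι} (hi : k ≠ i) (hj : k ≠ j)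
    (M : Matrix (Fin 2) (Fin 2) ℂ) (ξ : QubitSpace ι) :
    swapOp i j (siteOp k M ξ) = siteOp k M (swapOp i j ξ) := by
  ext x
  simp only [swapOp_apply, siteOp_apply, Function.comp_apply, Equiv.swap_apply_of_ne_of_ne hi hj]
  refine Finset.sum_congr rfl fun b _ => ?_
  rw [Function.update_comp_equiv, Equiv.symm_swap, Equiv.swap_apply_of_ne_of_ne hi hj]

theorem swapOp_conj {i j k : ι} (hij : i ≠ j) (hik : i ≠ k) (ξ : QubitSpace ι) :
    swapOp j k (swapOp i j (swapOp j k ξ)) = swapOp i k ξ := by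
  ext x
  simp only [swapOp_apply]
  refine congrArg ξ.ofLp (funext fun l => congrArg x ?_)
  have := Equiv.swap_apply_apply (Equiv.swap j k) i j
  rw [Equiv.swap_apply_of_ne_of_ne hij hik, Equiv.swap_apply_left] at this
  rw [this]
  simp

theorem swapOp_swapOp_disjoint {i j k l : ι} (hij : i ≠ j) (hkl : k ≠ l) (hik : i ≠ k)
    (hil : i ≠ l) (hjk : j ≠ k) (hjl : j ≠ l) (ξ : QubitSpace ι) :
    swapOp i j (swapOp k l ξ) = swapOp k l (swapOp i j ξ) := by
  ext x
  simp only [swapOp_apply]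
  refine congrArg ξ.ofLp ?_
  rw [Function.comp_assoc, Function.comp_assoc, ← Equiv.Perm.coe_mul, ← Equiv.Perm.coe_mul,
    (Equiv.Perm.disjoint_swap_swap (x := i) (y := j) (z := k) (t := l) (by simp [*])).commute.eq]

theorem comp_swap_eq {κ : Type} [DecidableEq κ] {i j : κ} (h : i ≠ j) (x : κ → Fin 2) :
    x ∘ Equiv.swap i j = Function.update (Function.update x i (x j)) j (x i) := by
  ext l
  by_cases hj : l = j
  · subst hj; simp
  by_cases hi : l = i
  · subst hi; simp [hj]
  simp [hi, hj, Equiv.swap_apply_of_ne_of_ne hi hj]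

/-- On antisymmetric states a one-site operator can be moved to the other site,
where it acts as its adjugate. -/
theorem sub_swapOp_siteOp {i j : ι} (h : i ≠ j) (M : Matrix (Fin 2) (Fin 2) ℂ)
    (ξ : QubitSpace ι) :
    siteOp i M ξ - swapOp i j (siteOp i M ξ) =
      siteOp j M.adjugate ξ - swapOp i j (siteOp j M.adjugate ξ) := by
  ext x
  obtain ⟨φ, hφ⟩ : ∃ φ : Fin 2 → Fin 2 → ℂ, ∀ a b,
      ξ (Function.update (Function.update x i a) j b) = φ a b := ⟨_, fun _ _ => rfl⟩
  have h1 : ∀ a, ξ (Function.update x i a) = φ a (x j) := fun a => by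
    rw [← hφ, ← Function.update_of_ne h.symm a x, Function.update_eq_self]
  have h2 : ∀ b, ξ (Function.update x j b) = φ (x i) b := fun a => by
    rw [← hφ, Function.update_eq_self]
  have h3 : ∀ a b c d, ξ (Function.update (Function.update (Function.update
      (Function.update x i a) j b) i c) j d) = φ c d := fun a b c d => by
    rw [← hφ, Function.update_comm h.symm, Function.update_idem, Function.update_idem]
  have h4 : ∀ a b c, ξ (Function.update (Function.update (Function.update x i a) j b) i c)
      = φ c b := fun a b c => by
    rw [← hφ, Function.update_comm h.symm, Function.update_idem]
  simp only [PiLp.sub_apply, swapOp_apply, siteOp_apply, comp_swap_eq h, Fin.sum_univ_two,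
    Matrix.adjugate_fin_two, h1, h2, h4, Function.update_self, Function.update_of_ne h,
    Function.update_idem, hφ]
  generalize x i = a
  generalize x j = b
  fin_cases a <;> fin_cases b <;> simp <;> ring

/-- Three qubits carry no totally antisymmetric state. -/
theorem sum_perm_three {i j k : ι} (hij : i ≠ j) (hik : i ≠ k) (hjk : j ≠ k)
    (ξ : QubitSpace ι) :
    ξ - swapOp i j ξ - swapOp i k ξ - swapOp j k ξ + swapOp i j (swapOp j k ξ)
      + swapOp j k (swapOp i j ξ) = 0 := by
  ext x
  obtain ⟨φ, hφ⟩ : ∃ φ : Fin 2 → Fin 2 → Fin 2 → ℂ, ∀ y : ι → Fin 2,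
      (∀ l, l ≠ i → l ≠ j → l ≠ k → y l = x l) → ξ y = φ (y i) (y j) (y k) := by
    refine ⟨fun a b c => ξ (Function.update (Function.update (Function.update x i a) j b) k c),
      fun y hy => congrArg ξ.ofLp (funext fun l => ?_)⟩
    by_cases hk : l = k
    · subst hk; simp
    by_cases hj : l = j
    · subst hj; simp [hk]
    by_cases hi : l = i
    · subst hi; simp [hk, hj]
    simp [hk, hj, hi, hy l hi hj hk]
  have hsw : ∀ {a b : ι} (y : ι → Fin 2), (a = i ∨ a = j ∨ a = k) → (b = i ∨ b = j ∨ b = k) →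
      (∀ l, l ≠ i → l ≠ j → l ≠ k → y l = x l) →
      ∀ l, l ≠ i → l ≠ j → l ≠ k → (y ∘ Equiv.swap a b) l = x l := by
    intro a b y ha hb hy l hi hj hk
    rw [Function.comp_apply, Equiv.swap_apply_of_ne_of_ne, hy l hi hj hk]
    · rintro rfl; tauto
    · rintro rfl; tauto
  have h0 : ∀ l, l ≠ i → l ≠ j → l ≠ k → x l = x l := fun _ _ _ _ => rfl
  have hij0 := hsw (a := i) (b := j) x (by simp) (by simp) h0
  have hik0 := hsw (a := i) (b := k) x (by simp) (by simp) h0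
  have hjk0 := hsw (a := j) (b := k) x (by simp) (by simp) h0
  simp only [PiLp.sub_apply, PiLp.add_apply, PiLp.zero_apply, swapOp_apply]
  rw [hφ _ h0, hφ _ hij0, hφ _ hik0, hφ _ hjk0, hφ _ (hsw _ (by simp) (by simp) hij0),
    hφ _ (hsw _ (by simp) (by simp) hjk0)]
  simp only [Function.comp_apply, Equiv.swap_apply_left, Equiv.swap_apply_right,
    Equiv.swap_apply_of_ne_of_ne hij.symm hjk, Equiv.swap_apply_of_ne_of_ne hik.symm hjk.symm,
    Equiv.swap_apply_of_ne_of_ne hij hik]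
  generalize x i = a
  generalize x j = b
  generalize x k = c
  fin_cases a <;> fin_cases b <;> fin_cases c <;> simp <;> ring

/-- The antisymmetrizer is self-adjoint, so this is `sub_swapOp_siteOp` read through the inner
product with test vectors. -/
theorem siteOp_of_antisymm {i j : ι} (h : i ≠ j) {e : QubitSpace ι} (he : swapOp i j e = -e)
    (M : Matrix (Fin 2) (Fin 2) ℂ) : siteOp i M e = siteOp j M.adjugate e := by
  refine ext_inner_right ℂ fun η => ?_
  have key : ∀ η : QubitSpace ι, inner ℂ e η = (1 / 2 : ℂ) * inner ℂ e (η - swapOp i j η) := by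
    intro η
    rw [inner_sub_right, ← swapOp_inner, he, inner_neg_left]
    ring
  rw [siteOp_inner, siteOp_inner, key, key (siteOp j _ η), sub_swapOp_siteOp h,
    Matrix.adjugate_conjTranspose]

/-- The singlet is invariant under `M ⊗ M` up to the determinant. For a rank-one projection the
determinant is zero, and this is how it is used for `P`. -/
theorem siteOp_siteOp_of_antisymm {i j : ι} (h : i ≠ j) {e : QubitSpace ι}
    (he : swapOp i j e = -e) (M : Matrix (Fin 2) (Fin 2) ℂ) :
    siteOp i M (siteOp j M e) = M.det • e := by
  rw [siteOp_commute h, siteOp_of_antisymm h he, siteOp_mul, Matrix.mul_adjugate, map_smul, map_one]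
  rfl

theorem sub_swapOp_siteOp_siteOp {i j : ι} (h : i ≠ j) (M : Matrix (Fin 2) (Fin 2) ℂ)
    (ξ : QubitSpace ι) :
    siteOp i M (siteOp j M ξ) - swapOp i j (siteOp i M (siteOp j M ξ)) =
      M.det • (ξ - swapOp i j ξ) := by
  rw [sub_swapOp_siteOp h, siteOp_mul, Matrix.adjugate_mul, map_smul, map_one]
  simp [smul_sub]

theorem swapOp_sub_swapOp (i j : ι) (ξ : QubitSpace ι) :
    swapOp i j (ξ - swapOp i j ξ) = -(ξ - swapOp i j ξ) := by
  rw [map_sub, swapOp_swapOp, neg_sub]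

/-- If a state is antisymmetric under the exchange of `i` and `j`, the exchange of `j` with a
third qubit has expectation `1 / 2`. -/
theorem inner_swapOp_of_antisymm {i j k : ι} (hij : i ≠ j) (hik : i ≠ k) (hjk : j ≠ k)
    {f : QubitSpace ι} (hf : swapOp i j f = -f) :
    inner ℂ f (swapOp j k f) = (1 / 2 : ℂ) * inner ℂ f f := by
  have h := congrArg (inner ℂ f) (sum_perm_three hij hik hjk f)
  have h1 : inner ℂ f (swapOp i k f) = inner ℂ f (swapOp j k f) := by
    have : swapOp i j (swapOp j k (swapOp i j f)) = swapOp i k f := by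
      rw [swapOp_comm i j, swapOp_comm j k, swapOp_comm i k]
      exact swapOp_conj hjk.symm hik.symm f
    rw [← this, ← swapOp_inner, hf, map_neg, inner_neg_neg]
  have h2 : inner ℂ f (swapOp i j (swapOp j k f)) = - inner ℂ f (swapOp j k f) := by
    rw [← swapOp_inner, hf, inner_neg_left]
  rw [hf, map_neg, inner_add_right, inner_add_right, inner_sub_right, inner_sub_right,
    inner_sub_right, inner_neg_right, inner_neg_right, inner_zero_right, h1, h2] at h
  linear_combination (-1 / 4 : ℂ) * h

-- A `*`-homomorphism between C*-algebras is contractive.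
open scoped Matrix.Norms.L2Operator in
theorem norm_siteOp_le_l2 (l : ι) (M : Matrix (Fin 2) (Fin 2) ℂ) : ‖siteOp l M‖ ≤ ‖M‖ :=
  NonUnitalStarAlgHom.norm_apply_le (siteOp l) M

/-- The operator norm of a `2 × 2` matrix. -/
def siteNorm (M : Matrix (Fin 2) (Fin 2) ℂ) : ℝ :=
  ‖Matrix.toEuclideanCLM (n := Fin 2) (𝕜 := ℂ) M‖

theorem siteNorm_nonneg (M : Matrix (Fin 2) (Fin 2) ℂ) : 0 ≤ siteNorm M := norm_nonneg _

theorem norm_siteOp_le (l : ι) (M : Matrix (Fin 2) (Fin 2) ℂ) (ξ : QubitSpace ι) :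
    ‖siteOp l M ξ‖ ≤ siteNorm M * ‖ξ‖ :=
  (siteOp l M).le_of_opNorm_le (norm_siteOp_le_l2 l M) ξ

end SiteOperators

/-! ### Commuting with projections and finite-dimensional duality -/

section General

variable {E : Type} [NormedAddCommGroup E] [InnerProductSpace ℂ E] [FiniteDimensional ℂ E]

theorem starProjection_comm_of_mem {V : Submodule ℂ E} {O O' : E →L[ℂ] E}
    (hadj : ∀ x y, inner ℂ (O x) y = inner ℂ x (O' y))
    (hO : ∀ x ∈ V, O x ∈ V) (hO' : ∀ x ∈ V, O' x ∈ V) (x : E) :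
    V.starProjection (O x) = O (V.starProjection x) := by
  refine Submodule.eq_starProjection_of_mem_orthogonal
    (hO _ (Submodule.starProjection_apply_mem _ _)) ?_
  rw [← map_sub, Submodule.mem_orthogonal']
  intro y hy
  rw [hadj]
  exact (Submodule.mem_orthogonal' _ _).1 (Submodule.sub_starProjection_mem_orthogonal x) _
    (hO' _ hy)

/-- In finite dimension, a vector of `M` orthogonal to `M ∩ ker K` is the projection to `M` of a
vector in the range of the adjoint `K'` of `K`. -/
theorem exists_eq_starProjection_of_mem_orthogonal {M : Submodule ℂ E} {K K' : E →L[ℂ] E}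
    (hadj : ∀ x y, inner ℂ (K x) y = inner ℂ x (K' y)) {k : E} (hk : k ∈ M)
    (hk' : ∀ w ∈ M, K w = 0 → inner ℂ w k = 0) : ∃ g, k = M.starProjection (K' g) := by
  have hker : LinearMap.ker K.toLinearMap = (LinearMap.range K'.toLinearMap)ᗮ := by
    ext x
    rw [Submodule.mem_orthogonal', LinearMap.mem_ker]
    constructor
    · rintro hx _ ⟨g, rfl⟩
      have := hadj x g
      simp only [ContinuousLinearMap.coe_coe] at hx ⊢
      rw [← this, hx, inner_zero_left]
    · intro h
      refine ext_inner_right ℂ fun g => ?_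
      have := hadj x g
      simp only [ContinuousLinearMap.coe_coe] at this ⊢
      rw [this, inner_zero_left]
      exact h _ ⟨g, rfl⟩
  -- Intersections of orthogonal complements are complements of sums, and finite-dimensional
  -- subspaces are closed. So `k` lies in the sum of `Mᗮ` and the range of `K'`, and projecting to
  -- `M` removes the first part.
  have h1 : M ⊓ LinearMap.ker K.toLinearMap = (Mᗮ ⊔ LinearMap.range K'.toLinearMap)ᗮ := by
    rw [← Submodule.inf_orthogonal, Submodule.orthogonal_orthogonal, hker]
  have h2 : k ∈ Mᗮ ⊔ LinearMap.range K'.toLinearMap := by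
    rw [← Submodule.orthogonal_orthogonal (Mᗮ ⊔ _), ← h1, Submodule.mem_orthogonal]
    rintro w ⟨hw, hw'⟩
    exact hk' w hw hw'
  obtain ⟨a, ha, _, ⟨g, rfl⟩, rfl⟩ := Submodule.mem_sup.1 h2
  refine ⟨g, ?_⟩
  have := Submodule.starProjection_eq_self_iff.2 hk
  rw [map_add, (Submodule.starProjection_apply_eq_zero_iff M).2 ha, zero_add] at this
  exact this.symm

end General

/-! ### Ground spaces as exchange-symmetric states, and closing the ring -/

section ChainSpace

variable {ι : Type} [Fintype ι] [DecidableEq ι]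

/-- The states on which `T_i ξ` is symmetric under the exchange of the sites `i` and `i + 1`,
for all bonds of the interval `[p, q]` of the sequence of sites `s`. -/
def chainSpace (T : Matrix (Fin 2) (Fin 2) ℂ) (s : ℕ → ι) (p q : ℕ) :
    Submodule ℂ (QubitSpace ι) where
  carrier := {ξ | ∀ i, p ≤ i → i < q →
    swapOp (s i) (s (i + 1)) (siteOp (s i) T ξ) = siteOp (s i) T ξ}
  add_mem' := fun ha hb i h1 h2 => by simp only [map_add, ha i h1 h2, hb i h1 h2]
  zero_mem' := fun i _ _ => by simp only [map_zero]
  smul_mem' := fun c x hx i h1 h2 => by simp only [map_smul, hx i h1 h2]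

/-- The orthogonal projector onto the chain space. -/
def chainProj (T : Matrix (Fin 2) (Fin 2) ℂ) (s : ℕ → ι) (p q : ℕ) :
    QubitSpace ι →L[ℂ] QubitSpace ι :=
  (chainSpace T s p q).starProjection

variable {T : Matrix (Fin 2) (Fin 2) ℂ} {s : ℕ → ι} {N p q : ℕ}

theorem mem_chainSpace {ξ : QubitSpace ι} : ξ ∈ chainSpace T s p q ↔ ∀ i, p ≤ i → i < q →
    swapOp (s i) (s (i + 1)) (siteOp (s i) T ξ) = siteOp (s i) T ξ := Iff.rfl

theorem chainSpace_mono {p' q' : ℕ} (hp : p ≤ p') (hq : q' ≤ q) :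
    chainSpace T s p q ≤ chainSpace T s p' q' :=
  fun _ h i h1 h2 => h i (hp.trans h1) (h2.trans_le hq)

theorem siteOp_mem_chainSpace (hs : Set.InjOn s (Set.Iic N)) {k : ℕ} (hk : k ≤ N) (hq : q ≤ N)
    (h : k < p ∨ q < k) (M : Matrix (Fin 2) (Fin 2) ℂ) {ξ : QubitSpace ι}
    (hξ : ξ ∈ chainSpace T s p q) : siteOp (s k) M ξ ∈ chainSpace T s p q := by
  intro i h1 h2
  have e1 : s k ≠ s i := hs.ne hk (Set.mem_Iic.2 (by omega)) (by omega)
  have e2 : s k ≠ s (i + 1) := hs.ne hk (Set.mem_Iic.2 (by omega)) (by omega)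
  rw [siteOp_commute e1.symm, swapOp_siteOp_of_ne e1 e2, hξ i h1 h2]

theorem swapOp_mem_chainSpace (hs : Set.InjOn s (Set.Iic N)) {k l : ℕ} (hk : k ≤ N) (hl : l ≤ N)
    (hkl : k ≠ l) (hq : q ≤ N)
    (h : k < p ∨ q < k) (h' : l < p ∨ q < l) {ξ : QubitSpace ι}
    (hξ : ξ ∈ chainSpace T s p q) : swapOp (s k) (s l) ξ ∈ chainSpace T s p q := by
  intro i h1 h2
  have e : ∀ {a b}, a ≤ N → b ≤ N → a ≠ b → s a ≠ s b := fun ha hb hab => hs.ne ha hb hab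
  rw [← swapOp_siteOp_of_ne (e _ _ _) (e _ _ _), swapOp_swapOp_disjoint (e _ _ _) (e _ _ _)
    (e _ _ _) (e _ _ _) (e _ _ _) (e _ _ _), hξ i h1 h2]
  all_goals omega

theorem siteOp_cancel {M : Matrix (Fin 2) (Fin 2) ℂ} (hM : IsUnit M.det) (l : ι)
    {ξ η : QubitSpace ι} (h : siteOp l M ξ = siteOp l M η) : ξ = η := by
  have := congrArg (siteOp l M⁻¹) h
  simpa only [siteOp_mul, Matrix.nonsing_inv_mul M hM, map_one, one_apply_eq_self]
    using this

/-- Closing the chain to a ring: on the chain space, `T_p ^ m ξ` is symmetric under the exchange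
of the end points `p` and `p + m`. -/
theorem swapOp_siteOp_pow (hs : Set.InjOn s (Set.Iic N)) (hT : IsUnit T.det) (m : ℕ)
    (hN : p + m ≤ N) {ξ : QubitSpace ι} (hξ : ξ ∈ chainSpace T s p (p + m)) :
    swapOp (s p) (s (p + m)) (siteOp (s p) (T ^ m) ξ) = siteOp (s p) (T ^ m) ξ := by
  induction m with
  | zero => ext x; simp [swapOp_apply]
  | succ m ih =>
    have ih := ih (by omega) (chainSpace_mono le_rfl (by omega) hξ)
    rcases Nat.eq_zero_or_pos m with rfl | hm
    · simpa using hξ p le_rfl (by omega)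
    have e : ∀ {a b}, a ≤ N → b ≤ N → a ≠ b → s a ≠ s b := fun ha hb hab => hs.ne ha hb hab
    have e1 : s p ≠ s (p + m) := e (by omega) (by omega) (by omega)
    have e2 : s p ≠ s (p + (m + 1)) := e (by omega) (by omega) (by omega)
    have e3 : s (p + m) ≠ s (p + (m + 1)) := e (by omega) (by omega) (by omega)
    have hl := hξ (p + m) (by omega) (by omega)
    rw [add_assoc] at hl
    -- After applying `T` at `p + m` as well, the state is fixed by the exchanges (p, p+m) and (p+m,
    -- p+m+1), hence by their conjugate (p, p+m+1); `T` is then cancelled.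
    refine siteOp_cancel hT (s (p + m)) ?_
    rw [← swapOp_siteOp_of_ne e1.symm e3]
    rw [swapOp_comm (s p), ← swapOp_conj e3.symm e2.symm, swapOp_comm (s (p + m)) (s p),
      swapOp_comm (s (p + (m + 1))) (s (p + m))]
    have f1 : swapOp (s p) (s (p + m)) (siteOp (s (p + m)) T (siteOp (s p) (T ^ (m + 1)) ξ)) =
        siteOp (s (p + m)) T (siteOp (s p) (T ^ (m + 1)) ξ) := by
      rw [pow_succ', ← siteOp_mul, swapOp_siteOp_right, swapOp_siteOp_left, ih,
        siteOp_commute e1]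
    have f2 : swapOp (s (p + m)) (s (p + (m + 1)))
        (siteOp (s (p + m)) T (siteOp (s p) (T ^ (m + 1)) ξ)) =
        siteOp (s (p + m)) T (siteOp (s p) (T ^ (m + 1)) ξ) := by
      rw [siteOp_commute e1.symm, swapOp_siteOp_of_ne e1 e2, hl]
    rw [f1, f2, f1]

/-- The bond at the left end of the chain can be replaced by the bond closing the ring. -/
theorem mem_chainSpace_of_ring (hs : Set.InjOn s (Set.Iic N)) (hT : IsUnit T.det) (m : ℕ)
    (hN : p + (m + 1) ≤ N) {ξ : QubitSpace ι} (hξ : ξ ∈ chainSpace T s (p + 1) (p + (m + 1)))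
    (h : swapOp (s p) (s (p + (m + 1))) (siteOp (s p) (T ^ (m + 1)) ξ) =
      siteOp (s p) (T ^ (m + 1)) ξ) : ξ ∈ chainSpace T s p (p + (m + 1)) := by
  intro i h1 h2
  rcases Nat.lt_or_eq_of_le h1 with h1 | rfl
  · exact hξ i h1 h2
  rcases Nat.eq_zero_or_pos m with rfl | hm
  · simpa using h
  have e : ∀ {a b}, a ≤ N → b ≤ N → a ≠ b → s a ≠ s b := fun ha hb hab => hs.ne ha hb hab
  have e1 : s p ≠ s (p + 1) := e (by omega) (by omega) (by omega)
  have e2 : s p ≠ s (p + (m + 1)) := e (by omega) (by omega) (by omega)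
  have e3 : s (p + 1) ≠ s (p + (m + 1)) := e (by omega) (by omega) (by omega)
  have hpm : p + (m + 1) = p + 1 + m := by omega
  have hr := swapOp_siteOp_pow hs hT m (by omega) (hpm ▸ hξ)
  rw [← hpm] at hr
  have hTm : IsUnit (T ^ m).det := by rw [Matrix.det_pow]; exact hT.pow m
  -- The state `T_{p+1}^m T_p^{m+1} ξ` is fixed by (p, p+m+1) by hypothesis and by (p+1, p+m+1) by
  -- closing the shorter chain, hence by (p, p+1). The equal powers `T ^ m` on these two sites
  -- commute with that exchange and cancel.
  refine siteOp_cancel hTm (s p) (siteOp_cancel hTm (s (p + 1)) ?_)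
  have f0 : siteOp (s (p + 1)) (T ^ m) (siteOp (s p) (T ^ m) (siteOp (s p) T ξ)) =
      siteOp (s (p + 1)) (T ^ m) (siteOp (s p) (T ^ (m + 1)) ξ) := by
    rw [pow_succ, siteOp_mul]
  have f1 : swapOp (s p) (s (p + (m + 1)))
      (siteOp (s (p + 1)) (T ^ m) (siteOp (s p) (T ^ (m + 1)) ξ)) =
      siteOp (s (p + 1)) (T ^ m) (siteOp (s p) (T ^ (m + 1)) ξ) := by
    rw [swapOp_siteOp_of_ne e1.symm e3, h]
  have f2 : swapOp (s (p + 1)) (s (p + (m + 1)))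
      (siteOp (s (p + 1)) (T ^ m) (siteOp (s p) (T ^ (m + 1)) ξ)) =
      siteOp (s (p + 1)) (T ^ m) (siteOp (s p) (T ^ (m + 1)) ξ) := by
    rw [siteOp_commute e1.symm, swapOp_siteOp_of_ne e1 e2, hr]
  have g : ∀ ζ : QubitSpace ι, swapOp (s p) (s (p + 1))
      (siteOp (s (p + 1)) (T ^ m) (siteOp (s p) (T ^ m) ζ)) =
      siteOp (s (p + 1)) (T ^ m) (siteOp (s p) (T ^ m) (swapOp (s p) (s (p + 1)) ζ)) := by
    intro ζ
    rw [swapOp_siteOp_right, swapOp_siteOp_left, siteOp_commute e1]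
  calc _ = swapOp (s p) (s (p + 1))
        (siteOp (s (p + 1)) (T ^ m) (siteOp (s p) (T ^ m) (siteOp (s p) T ξ))) := by
        rw [g]
    _ = _ := by
        rw [f0, ← swapOp_conj e2 e1, swapOp_comm _ (s (p + 1)), f2, f1, f2]

theorem chainProj_siteOp (hs : Set.InjOn s (Set.Iic N)) {k : ℕ} (hk : k ≤ N)
    (hq : q ≤ N) (h : k < p ∨ q < k) (M : Matrix (Fin 2) (Fin 2) ℂ) (ξ : QubitSpace ι) :
    chainProj T s p q (siteOp (s k) M ξ) = siteOp (s k) M (chainProj T s p q ξ) :=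
  starProjection_comm_of_mem (siteOp_inner _ M)
    (fun _ => siteOp_mem_chainSpace hs hk hq h M) (fun _ => siteOp_mem_chainSpace hs hk hq h Mᴴ) ξ

/-- The antisymmetric part contributes −‖e‖², which absorbs the cross term: ‖a‖² + 2‖a‖‖e‖ − ‖e‖² ≤
2‖a‖². -/
theorem re_inner_swapOp_add_le {i j : ι} {e : QubitSpace ι} (he : swapOp i j e = -e)
    (a : QubitSpace ι) : (inner ℂ (a + e) (swapOp i j (a + e))).re ≤ 2 * ‖a‖ ^ 2 := by
  have h1 : (inner ℂ (a + e) (swapOp i j (a + e))).re =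
      (inner ℂ a (swapOp i j a)).re - 2 * (inner ℂ a e).re - ‖e‖ ^ 2 := by
    have h2 : inner ℂ e (swapOp i j a) = - inner ℂ e a := by
      rw [← swapOp_inner, he, inner_neg_left]
    rw [map_add, he, inner_add_left, inner_add_right, inner_add_right, inner_neg_right,
      inner_neg_right, h2, ← inner_conj_symm e a]
    simp only [Complex.add_re, Complex.neg_re, Complex.conj_re]
    have h3 := inner_self_eq_norm_sq (𝕜 := ℂ) e
    rw [RCLike.re_eq_complex_re] at h3
    rw [h3]
    ring
  have h2 : (inner ℂ a (swapOp i j a)).re ≤ ‖a‖ * ‖a‖ := by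
    have := re_inner_le_norm (𝕜 := ℂ) a (swapOp i j a)
    rwa [norm_swapOp] at this
  have h3 : -(inner ℂ a e).re ≤ ‖a‖ * ‖e‖ := by
    have := re_inner_le_norm (𝕜 := ℂ) a (-e)
    rwa [inner_neg_right, norm_neg] at this
  nlinarith [sq_nonneg (‖a‖ - ‖e‖)]

end ChainSpace

/-! ### Lower bound on the overlap with the chain extended by one site -/

section Extension

variable {ι : Type} [Fintype ι] [DecidableEq ι] {T : Matrix (Fin 2) (Fin 2) ℂ} {s : ℕ → ι}
  {N p q : ℕ}

theorem siteNorm_conjTranspose (M : Matrix (Fin 2) (Fin 2) ℂ) : siteNorm Mᴴ = siteNorm M := by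
  unfold siteNorm
  rw [← Matrix.star_eq_conjTranspose, map_star, ContinuousLinearMap.star_eq_adjoint]
  exact LinearIsometryEquiv.norm_map _ _

theorem sub_swap_adj (i j : ι) (M : Matrix (Fin 2) (Fin 2) ℂ) (x y : QubitSpace ι) :
    inner ℂ (((1 - swapOp i j) * siteOp i M) x) y =
      inner ℂ x ((siteOp i Mᴴ * (1 - swapOp i j)) y) := by
  simp only [mul_apply_eq_comp, _root_.sub_apply, one_apply_eq_self,
    inner_sub_left, map_sub, inner_sub_right, swapOp_inner, siteOp_inner]

/-- The duality lemma for `K = (1 - swap) B_i`: the range of its adjoint consists of the images of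
antisymmetric states under `Bᴴ`. -/
theorem exists_antisymm_of_mem_orthogonal {i j : ι} {M : Submodule ℂ (QubitSpace ι)}
    (B : Matrix (Fin 2) (Fin 2) ℂ) {k : QubitSpace ι} (hk : k ∈ M)
    (hk' : ∀ w ∈ M, swapOp i j (siteOp i B w) = siteOp i B w → inner ℂ w k = 0) :
    ∃ g, k = M.starProjection (siteOp i Bᴴ (g - swapOp i j g)) := by
  obtain ⟨g, hg⟩ := exists_eq_starProjection_of_mem_orthogonal (sub_swap_adj i j B) hk
    (fun w hw h => hk' w hw (by
      simp only [mul_apply_eq_comp, _root_.sub_apply,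
        one_apply_eq_self] at h
      exact (sub_eq_zero.1 h).symm))
  exact ⟨g, by simpa using hg⟩

theorem chainProj_mem (ξ : QubitSpace ι) : chainProj T s p q ξ ∈ chainSpace T s p q :=
  Submodule.starProjection_apply_mem _ _

theorem inner_chainProj {ξ w : QubitSpace ι} (hw : w ∈ chainSpace T s p q) :
    inner ℂ w (chainProj T s p q ξ) = inner ℂ w ξ := by
  rw [chainProj, ← Submodule.inner_starProjection_left_eq_right,
    Submodule.starProjection_eq_self_iff.2 hw]

theorem chainProj_chainProj {p' q' : ℕ} (hp : p' ≤ p) (hq : q ≤ q') (x : QubitSpace ι) :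
    chainProj T s p' q' (chainProj T s p q x) = chainProj T s p' q' x := by
  have h : chainSpace T s p' q' ≤ chainSpace T s p q := chainSpace_mono hp hq
  exact DFunLike.congr_fun (Submodule.starProjection_comp_starProjection_of_le h) x

theorem re_inner_swapOp_le_base (hs : Set.InjOn s (Set.Iic N)) (hq : q + 1 ≤ N)
    (ξ : QubitSpace ι) :
    (inner ℂ (siteOp (s (q + 1)) Tᴴ ξ)
      (swapOp (s q) (s (q + 1)) (siteOp (s (q + 1)) Tᴴ ξ))).re ≤
      2 * siteNorm T ^ 2 * ‖chainProj T s q (q + 1) ξ‖ ^ 2 := by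
  have e1 : s q ≠ s (q + 1) := hs.ne (Set.mem_Iic.2 (by omega)) hq (by omega)
  set ξ' := chainProj T s q (q + 1) ξ with hξ'
  obtain ⟨g, hg⟩ := exists_antisymm_of_mem_orthogonal (i := s q) (j := s (q + 1)) (M := ⊤) T
    (k := ξ - ξ') Submodule.mem_top (by
      intro w _ hw
      have hw' : w ∈ chainSpace T s q (q + 1) := by
        intro i h1 h2
        obtain rfl : i = q := by omega
        exact hw
      rw [inner_sub_right, hξ', inner_chainProj hw', sub_self])
  rw [Submodule.starProjection_eq_self_iff.2 Submodule.mem_top] at hg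
  have he := swapOp_sub_swapOp (s q) (s (q + 1)) g
  set e := g - swapOp (s q) (s (q + 1)) g
  -- Applying `Tᴴ` at the second site turns the discarded component into a multiple of the
  -- antisymmetric state `e`, so it cannot increase the bound.
  have hξe : siteOp (s (q + 1)) Tᴴ ξ = siteOp (s (q + 1)) Tᴴ ξ' + Tᴴ.det • e := by
    rw [← siteOp_siteOp_of_antisymm e1 he, ← siteOp_commute e1.symm, ← hg, ← map_add]
    congr 1
    abel
  rw [hξe]
  refine (re_inner_swapOp_add_le (e := Tᴴ.det • e) (by rw [map_smul, he, smul_neg]) _).trans ?_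
  have := norm_siteOp_le (s (q + 1)) Tᴴ ξ'
  rw [siteNorm_conjTranspose] at this
  have h2 : ‖siteOp (s (q + 1)) Tᴴ ξ'‖ ^ 2 ≤ (siteNorm T * ‖ξ'‖) ^ 2 := by gcongr
  rw [mul_pow] at h2
  linarith

/-- Moving `M` to site j makes it the adjugate. The exchange carries one copy to k, where both
copies meet; what is left is an exchange expectation in a state antisymmetric in i, j, which equals
one half. -/
theorem re_inner_swapOp_eq {i j k : ι} (hij : i ≠ j) (hik : i ≠ k) (hjk : j ≠ k)
    {e : QubitSpace ι} (he : swapOp i j e = -e) (M : Matrix (Fin 2) (Fin 2) ℂ) :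
    (inner ℂ (siteOp i M e) (swapOp k j (siteOp i M e))).re =
      1 / 2 * ‖siteOp k M.adjugateᴴ e‖ ^ 2 := by
  set B := M.adjugate with hB
  set f := siteOp k Bᴴ e with hf'
  have hf : swapOp i j f = -f := by
    rw [hf', swapOp_siteOp_of_ne hik.symm hjk.symm, he, map_neg]
  have h1 : inner ℂ (siteOp i M e) (swapOp k j (siteOp i M e)) = inner ℂ f (swapOp j k f) := by
    rw [siteOp_of_antisymm hij he, ← hB, swapOp_siteOp_right, hf', swapOp_comm j k,
      swapOp_siteOp_left]
    have h := siteOp_inner k Bᴴ (siteOp j B e) (swapOp k j e)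
    rw [Matrix.conjTranspose_conjTranspose] at h
    rw [← h, siteOp_commute hjk.symm, siteOp_inner]
  rw [h1, inner_swapOp_of_antisymm hij hik hjk hf, inner_self_eq_norm_sq_to_K]
  have : ((1 / 2 : ℂ) * (RCLike.ofReal ‖f‖ : ℂ) ^ 2) = ((1 / 2 * ‖f‖ ^ 2 : ℝ) : ℂ) := by
    push_cast; rfl
  rw [this, Complex.ofReal_re]

/-- Adding a site on the left changes the projection of ξ to that of `ξ + R` on the shorter chain,
where `R` comes from a state antisymmetric under the ring bond. The quadratic form at `ξ + R` is at
least that at ξ: the cross terms vanish and the `R` term is nonnegative. The induction hypothesis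
for `ξ + R` then suffices. -/
theorem re_inner_swapOp_le_step (hs : Set.InjOn s (Set.Iic N)) (hT : IsUnit T.det) {k : ℕ}
    (hk : 0 < k) (hN : p + k + 1 ≤ N)
    (ih : ∀ ξ ∈ chainSpace T s (p + 1) (p + k),
      (inner ℂ (siteOp (s (p + k + 1)) Tᴴ ξ)
        (swapOp (s (p + k)) (s (p + k + 1)) (siteOp (s (p + k + 1)) Tᴴ ξ))).re ≤
        2 * siteNorm T ^ 2 * ‖chainProj T s (p + 1) (p + k + 1) ξ‖ ^ 2)
    {ξ : QubitSpace ι} (hξ : ξ ∈ chainSpace T s p (p + k)) :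
    (inner ℂ (siteOp (s (p + k + 1)) Tᴴ ξ)
      (swapOp (s (p + k)) (s (p + k + 1)) (siteOp (s (p + k + 1)) Tᴴ ξ))).re ≤
      2 * siteNorm T ^ 2 * ‖chainProj T s p (p + k + 1) ξ‖ ^ 2 := by
  have ne : ∀ {a b}, a ≤ N → b ≤ N → a ≠ b → s a ≠ s b := fun ha hb hab => hs.ne ha hb hab
  have epq : s p ≠ s (p + k) := ne (by omega) (by omega) (by omega)
  have epr : s p ≠ s (p + k + 1) := ne (by omega) (by omega) (by omega)
  have eqr : s (p + k) ≠ s (p + k + 1) := ne (by omega) (by omega) (by omega)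
  set χ := chainProj T s p (p + k + 1) ξ with hχ
  have hM : χ ∈ chainSpace T s (p + 1) (p + k + 1) :=
    chainSpace_mono (by omega) le_rfl (chainProj_mem ξ)
  -- The new left bond is replaced by the ring bond (p, p+k+1), which involves no interior site. The
  -- antisymmetrizer therefore commutes with the projector of [p+1, p+k].
  obtain ⟨g, hg⟩ := exists_antisymm_of_mem_orthogonal (i := s p) (j := s (p + k + 1))
    (M := chainSpace T s (p + 1) (p + k + 1)) (T ^ (k + 1))
    (k := χ - chainProj T s (p + 1) (p + k + 1) ξ) (sub_mem hM (chainProj_mem ξ)) (by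
      intro w hw hw'
      have hw2 : w ∈ chainSpace T s p (p + k + 1) := mem_chainSpace_of_ring hs hT k hN hw hw'
      rw [inner_sub_right, hχ, inner_chainProj hw2, inner_chainProj hw, sub_self])
  set g' := chainProj T s (p + 1) (p + k) g with hg'
  have hU : ∀ x, chainProj T s (p + 1) (p + k + 1) (chainProj T s (p + 1) (p + k) x) =
      chainProj T s (p + 1) (p + k + 1) x :=
    chainProj_chainProj le_rfl (Nat.le_succ _)
  have hcomm : ∀ x, chainProj T s (p + 1) (p + k) (swapOp (s p) (s (p + k + 1)) x) =
      swapOp (s p) (s (p + k + 1)) (chainProj T s (p + 1) (p + k) x) :=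
    starProjection_comm_of_mem (swapOp_inner _ _)
      (fun _ => swapOp_mem_chainSpace hs (by omega) (by omega) (by omega) (by omega) (by omega)
        (by omega))
      (fun _ => swapOp_mem_chainSpace hs (by omega) (by omega) (by omega) (by omega) (by omega)
        (by omega))
  have he := swapOp_sub_swapOp (s p) (s (p + k + 1)) g'
  have heU : g' - swapOp (s p) (s (p + k + 1)) g' ∈ chainSpace T s (p + 1) (p + k) :=
    sub_mem (chainProj_mem g) (swapOp_mem_chainSpace hs (by omega) (by omega) (by omega)
      (by omega) (by omega) (by omega) (chainProj_mem g))
  have hR1 : chainProj T s (p + 1) (p + k)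
      (siteOp (s p) (T ^ (k + 1))ᴴ (g - swapOp (s p) (s (p + k + 1)) g)) =
      siteOp (s p) (T ^ (k + 1))ᴴ (g' - swapOp (s p) (s (p + k + 1)) g') := by
    rw [chainProj_siteOp hs (by omega) (by omega) (by omega), map_sub, hcomm]
  set e := g' - swapOp (s p) (s (p + k + 1)) g' with he'
  set R := siteOp (s p) (T ^ (k + 1))ᴴ e with hR
  have hRU : R ∈ chainSpace T s (p + 1) (p + k) :=
    siteOp_mem_chainSpace hs (by omega) (by omega) (by omega) _ heU
  have hχ2 : χ = chainProj T s (p + 1) (p + k + 1) (ξ + R) := by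
    have h1 : χ - chainProj T s (p + 1) (p + k + 1) ξ = chainProj T s (p + 1) (p + k + 1) R := by
      rw [hg]
      exact (hU _).symm.trans (by rw [hR1])
    rw [map_add, ← h1]
    abel
  rw [hχ2]
  refine le_trans ?_ (ih _ (add_mem (chainSpace_mono (by omega) le_rfl hξ) hRU))
  have hTR : siteOp (s (p + k + 1)) Tᴴ R = Tᴴ.det • siteOp (s p) (T ^ k)ᴴ e := by
    rw [hR, pow_succ, Matrix.conjTranspose_mul, Matrix.conjTranspose_pow]
    rw [(Commute.pow_right (Commute.refl Tᴴ) k).eq, ← siteOp_mul, siteOp_commute epr.symm,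
      siteOp_commute epr.symm, siteOp_siteOp_of_antisymm epr he, map_smul]
  -- With the power of `T` moved to the left argument, that argument is symmetric under (p, p+k), by
  -- closing the chain of ξ, while the exchanged `e` is antisymmetric under it.
  have hcross : inner ℂ (siteOp (s (p + k + 1)) Tᴴ ξ)
      (swapOp (s (p + k)) (s (p + k + 1)) (siteOp (s p) (T ^ k)ᴴ e)) = 0 := by
    set ζ := siteOp (s (p + k + 1)) Tᴴ (siteOp (s p) (T ^ k) ξ) with hζ
    have h1 : swapOp (s p) (s (p + k)) ζ = ζ := by
      rw [hζ, swapOp_siteOp_of_ne epr.symm eqr.symm, swapOp_siteOp_pow hs hT k (by omega) hξ]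
    have h2 : swapOp (s p) (s (p + k)) (swapOp (s (p + k)) (s (p + k + 1)) e) =
        -swapOp (s (p + k)) (s (p + k + 1)) e := by
      have h3 : swapOp (s p) (s (p + k)) (swapOp (s (p + k)) (s (p + k + 1)) e) =
          swapOp (s (p + k)) (s (p + k + 1)) (swapOp (s p) (s (p + k + 1)) e) := by
        rw [← swapOp_conj epq epr e, swapOp_swapOp]
      rw [h3, he, map_neg]
    rw [swapOp_siteOp_of_ne epq epr, ← siteOp_inner, siteOp_commute epr, ← hζ]
    have h4 : inner ℂ ζ (swapOp (s (p + k)) (s (p + k + 1)) e) =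
        - inner ℂ ζ (swapOp (s (p + k)) (s (p + k + 1)) e) := by
      conv_lhs => rw [← h1, swapOp_inner, h2, inner_neg_right]
    exact self_eq_neg.1 h4
  have hpos : 0 ≤ (inner ℂ (siteOp (s p) (T ^ k)ᴴ e)
      (swapOp (s (p + k)) (s (p + k + 1)) (siteOp (s p) (T ^ k)ᴴ e))).re := by
    rw [re_inner_swapOp_eq epr epq eqr.symm he]
    positivity
  set a := siteOp (s (p + k + 1)) Tᴴ ξ
  set b := siteOp (s p) (T ^ k)ᴴ e
  have hcross' : inner ℂ b (swapOp (s (p + k)) (s (p + k + 1)) a) = 0 := by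
    rw [← swapOp_inner, ← inner_conj_symm, hcross, map_zero]
  rw [map_add, hTR, map_add, map_smul, inner_add_left, inner_add_right, inner_add_right,
    inner_smul_left, inner_smul_left, inner_smul_right, inner_smul_right, hcross, hcross',
    ← mul_assoc, ← Complex.normSq_eq_conj_mul_self]
  simp only [mul_zero, Complex.add_re, Complex.re_ofReal_mul, Complex.zero_re]
  nlinarith [mul_nonneg (Complex.normSq_nonneg Tᴴ.det) hpos]

/-- The key lower bound on the overlap of a state of the chain space with the chain space of the
interval extended by one site. -/
theorem re_inner_swapOp_le_norm_chainProj (hs : Set.InjOn s (Set.Iic N)) (hT : IsUnit T.det)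
    (hpq : p ≤ q) (hN : q + 1 ≤ N) {ξ : QubitSpace ι} (hξ : ξ ∈ chainSpace T s p q) :
    (inner ℂ (siteOp (s (q + 1)) Tᴴ ξ)
      (swapOp (s q) (s (q + 1)) (siteOp (s (q + 1)) Tᴴ ξ))).re ≤
      2 * siteNorm T ^ 2 * ‖chainProj T s p (q + 1) ξ‖ ^ 2 := by
  obtain ⟨k, rfl⟩ := Nat.exists_eq_add_of_le hpq
  clear hpq
  induction k generalizing p ξ with
  | zero => exact re_inner_swapOp_le_base hs hN ξ
  | succ k ih =>
    refine re_inner_swapOp_le_step hs hT (Nat.succ_pos k) hN (fun η hη => ?_) hξ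
    have h := @ih (p + 1) η
    rw [show p + 1 + k = p + (k + 1) by omega] at h
    exact h hN hη

end Extension

/-! ### States orthogonal to the extended chain space inherit localization -/

section Localization

variable {ι : Type} [Fintype ι] [DecidableEq ι] {T P F W F' : Matrix (Fin 2) (Fin 2) ℂ} {s : ℕ → ι}
  {N p q : ℕ} {μ ν : ℂ}

/-- `P` is the orthogonal projector onto an eigenvector of `T` with eigenvalue `ν`, the other
eigenvalue being `μ`; `F` is a partial isometry from the range of `P` onto its complement. -/
structure IsEigenprojection (T P F : Matrix (Fin 2) (Fin 2) ℂ) (μ ν : ℂ) : Prop where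
  conjTranspose_eq : Pᴴ = P
  mul_self : P * P = P
  compl_mul : (1 - P) * T = μ • (1 - P)
  compl_mul_adjugate : (1 - P) * T.adjugate = ν • (1 - P)
  mul_eq : T * P = ν • P
  adjugate_mul : T.adjugate * P = μ • P
  det_matrix : T.det = μ * ν
  det_eq : P.det = 0
  det_compl : (1 - P).det = 0
  flip_mul : Fᴴ * F = P
  compl_flip : (1 - P) * F = F

namespace IsEigenprojection

theorem compl_conjTranspose (h : IsEigenprojection T P F μ ν) : (1 - P)ᴴ = 1 - P := by
  rw [Matrix.conjTranspose_sub, Matrix.conjTranspose_one, h.conjTranspose_eq]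

theorem compl_mul_self (h : IsEigenprojection T P F μ ν) : (1 - P) * (1 - P) = 1 - P := by
  rw [sub_mul, one_mul, mul_sub, mul_one, h.mul_self, sub_self, sub_zero]

theorem compl_mul_pow (h : IsEigenprojection T P F μ ν) (m : ℕ) :
    (1 - P) * T ^ m = μ ^ m • (1 - P) := by
  induction m with
  | zero => simp
  | succ m ih => rw [pow_succ, ← mul_assoc, ih, smul_mul_assoc, h.compl_mul, smul_smul, pow_succ]

/-- For 2 × 2 matrices the adjugate is `tr T - T`: same eigenvectors, eigenvalues exchanged. -/
theorem adjugate (h : IsEigenprojection T P F μ ν) :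
    IsEigenprojection T.adjugate P F ν μ := by
  have hT : T.adjugate.adjugate = T := by
    rw [Matrix.adjugate_adjugate _ (by simp)]
    simp
  refine ⟨h.conjTranspose_eq, h.mul_self, h.compl_mul_adjugate, ?_, h.adjugate_mul, ?_, ?_,
    h.det_eq, h.det_compl, h.flip_mul, h.compl_flip⟩
  · rw [hT, h.compl_mul]
  · rw [hT, h.mul_eq]
  · rw [Matrix.det_adjugate, h.det_matrix]
    simp [mul_comm]

end IsEigenprojection

theorem norm_inner_self (x : QubitSpace ι) : ‖inner ℂ x x‖ = ‖x‖ * ‖x‖ := by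
  rw [inner_self_eq_norm_sq_to_K, norm_pow, RCLike.norm_ofReal, abs_norm, pow_two]

theorem norm_sq_siteOp_of_proj {Q : Matrix (Fin 2) (Fin 2) ℂ} (h : Qᴴ = Q) (h' : Q * Q = Q)
    (l : ι) (ξ : QubitSpace ι) : inner ℂ ξ (siteOp l Q ξ) = (‖siteOp l Q ξ‖ : ℂ) ^ 2 := by
  have := inner_self_eq_norm_sq_to_K (𝕜 := ℂ) (siteOp l Q ξ)
  rw [siteOp_inner, siteOp_mul, h, h'] at this
  exact this

theorem norm_siteOp_le_of_proj {Q : Matrix (Fin 2) (Fin 2) ℂ} (h : Qᴴ = Q) (h' : Q * Q = Q)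
    (l : ι) (ξ : QubitSpace ι) : ‖siteOp l Q ξ‖ ≤ ‖ξ‖ := by
  have h1 := norm_sq_siteOp_of_proj h h' l ξ
  have h2 := norm_inner_le_norm (𝕜 := ℂ) ξ (siteOp l Q ξ)
  rw [h1, norm_pow, Complex.norm_real, norm_norm, pow_two] at h2
  rcases (norm_nonneg (siteOp l Q ξ)).eq_or_lt with h3 | h3
  · rw [← h3]; exact norm_nonneg _
  · exact le_of_mul_le_mul_right h2 h3

theorem siteOp_add_compl (P : Matrix (Fin 2) (Fin 2) ℂ) (l : ι) (ξ : QubitSpace ι) :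
    ξ = siteOp l P ξ + siteOp l (1 - P) ξ := by
  rw [map_sub, map_one, _root_.sub_apply, one_apply_eq_self]
  abel

/-- On states carrying `1 - P` at the added site, `Tᴴ` acts there as the scalar `star μ`. As `1 - P`
has determinant zero, projecting the neighbour by `1 - P` leaves a symmetric pair, so the exchange
expectation in the extension bound is a norm squared. -/
theorem norm_siteOp_compl_le_norm_chainProj (hs : Set.InjOn s (Set.Iic N)) (hT : IsUnit T.det)
    (h : IsEigenprojection T P F μ ν) (hpq : p ≤ q) (hN : q + 1 ≤ N) {ξ : QubitSpace ι}
    (hξ : ξ ∈ chainSpace T s p q) (hξ' : siteOp (s (q + 1)) (1 - P) ξ = ξ) :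
    ‖μ‖ ^ 2 * ‖siteOp (s q) (1 - P) ξ‖ ^ 2 ≤
      2 * siteNorm T ^ 2 * ‖chainProj T s p (q + 1) ξ‖ ^ 2 := by
  have e1 : s q ≠ s (q + 1) := hs.ne (Set.mem_Iic.2 (by omega)) hN (by omega)
  refine le_trans (le_of_eq ?_) (re_inner_swapOp_le_norm_chainProj hs hT hpq hN hξ)
  have h1 : siteOp (s (q + 1)) Tᴴ ξ = star μ • ξ := by
    have : Tᴴ * (1 - P) = star μ • (1 - P) := by
      rw [← h.compl_conjTranspose, ← Matrix.conjTranspose_mul, h.compl_conjTranspose, h.compl_mul,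
        Matrix.conjTranspose_smul, h.compl_conjTranspose]
    conv_lhs => rw [← hξ', siteOp_mul, this, map_smul]
    rw [_root_.smul_apply, hξ']
  have h2 : inner ℂ ξ (swapOp (s q) (s (q + 1)) ξ) = (‖siteOp (s q) (1 - P) ξ‖ : ℂ) ^ 2 := by
    rw [← norm_sq_siteOp_of_proj h.compl_conjTranspose h.compl_mul_self]
    have h3 : swapOp (s q) (s (q + 1)) (siteOp (s q) (1 - P) ξ) = siteOp (s q) (1 - P) ξ := by
      have := sub_swapOp_siteOp_siteOp e1 (1 - P) ξ
      rw [h.det_compl, zero_smul, hξ'] at this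
      exact (sub_eq_zero.1 this).symm
    rw [swapOp_siteOp_left] at h3
    conv_lhs => rw [← hξ', siteOp_inner, h.compl_conjTranspose]
    rw [hξ', h3]
  rw [h1, map_smul, inner_smul_left, inner_smul_right, h2, ← mul_assoc, mul_comm (starRingEnd ℂ _)]
  rw [Complex.mul_conj, Complex.normSq_eq_norm_sq, norm_star]
  norm_cast

/-- The constant in the localization estimate. -/
def localizationConst (T : Matrix (Fin 2) (Fin 2) ℂ) : ℝ :=
  Real.sqrt 2 * siteNorm T * (2 * siteNorm T * siteNorm (T ^ 2)⁻¹)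

theorem localizationConst_nonneg (T : Matrix (Fin 2) (Fin 2) ℂ) : 0 ≤ localizationConst T := by
  have := siteNorm_nonneg
  unfold localizationConst
  have := this T
  have := siteNorm_nonneg (T ^ 2)⁻¹
  positivity

/-- Only the last bond separates `x` from the extended chain space, so duality gives `x` as the
projection of `Tᴴ e` with `e` antisymmetric on that bond. Then η is `P` applied to `e` at the new
site. -/
theorem exists_eq_chainProj (hs : Set.InjOn s (Set.Iic N)) (hT : IsUnit T.det)
    (h : IsEigenprojection T P F μ ν) (hpq : p ≤ q) (hN : q + 2 ≤ N) {x : QubitSpace ι}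
    (hx : x ∈ chainSpace T s p (q + 1)) (hx' : ∀ w ∈ chainSpace T s p (q + 2), inner ℂ w x = 0) :
    ∃ η, siteOp (s (q + 1)) (1 - P) η = η ∧ siteOp (s (q + 2)) P η = η ∧
      ‖η‖ ≤ 2 * siteNorm T * siteNorm (T ^ 2)⁻¹ * ‖x‖ ∧
      siteOp (s (q + 2)) P x = star μ • chainProj T s p (q + 1) η := by
  have ne : ∀ {a b}, a ≤ N → b ≤ N → a ≠ b → s a ≠ s b := fun ha hb hab => hs.ne ha hb hab
  have e01 : s q ≠ s (q + 1) := ne (by omega) (by omega) (by omega)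
  have e02 : s q ≠ s (q + 2) := ne (by omega) (by omega) (by omega)
  have e12 : s (q + 1) ≠ s (q + 2) := ne (by omega) (by omega) (by omega)
  obtain ⟨g, hg⟩ := exists_antisymm_of_mem_orthogonal (i := s (q + 1)) (j := s (q + 2))
    (M := chainSpace T s p (q + 1)) T hx (by
      intro w hw hw'
      refine hx' w fun i h1 h2 => ?_
      rcases Nat.lt_or_eq_of_le (Nat.lt_succ_iff.1 h2) with h3 | rfl
      · exact hw i h1 h3
      · exact hw')
  change x = chainProj T s p (q + 1) _ at hg
  set g' := chainProj T s p q g with hg'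
  have hcomm : ∀ x, chainProj T s p q (swapOp (s (q + 1)) (s (q + 2)) x) =
      swapOp (s (q + 1)) (s (q + 2)) (chainProj T s p q x) :=
    starProjection_comm_of_mem (swapOp_inner _ _)
      (fun _ => swapOp_mem_chainSpace hs (by omega) (by omega) (by omega) (by omega) (by omega)
        (by omega))
      (fun _ => swapOp_mem_chainSpace hs (by omega) (by omega) (by omega) (by omega) (by omega)
        (by omega))
  have hx2 : x = chainProj T s p (q + 1)
      (siteOp (s (q + 1)) Tᴴ (g' - swapOp (s (q + 1)) (s (q + 2)) g')) := by
    rw [hg, ← chainProj_chainProj le_rfl (Nat.le_succ q),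
      chainProj_siteOp hs (by omega) (by omega) (by omega), map_sub, hcomm]
  have he := swapOp_sub_swapOp (s (q + 1)) (s (q + 2)) g'
  have heU : g' - swapOp (s (q + 1)) (s (q + 2)) g' ∈ chainSpace T s p q :=
    sub_mem (chainProj_mem g) (swapOp_mem_chainSpace hs (by omega) (by omega) (by omega)
      (by omega) (by omega) (by omega) (chainProj_mem g))
  set e := g' - swapOp (s (q + 1)) (s (q + 2)) g' with he'
  -- The extension bound is applied to `Tᴴ e` itself: its left side evaluates to one half of the
  -- squared norm of `T ^ 2` acting on `e` at the third site q.
  have hnorm : ‖siteOp (s q) (T ^ 2) e‖ ≤ 2 * siteNorm T * ‖x‖ := by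
    have h1 := re_inner_swapOp_le_norm_chainProj hs hT hpq (by omega)
      (siteOp_mem_chainSpace hs (k := q + 1) (by omega) (by omega) (by omega) Tᴴ heU)
    have h2 := re_inner_swapOp_eq (k := s q) e12.symm e02.symm e01.symm
      (by rw [swapOp_comm, he]) (((T ^ 2)ᴴ).adjugate)
    rw [← hx2, siteOp_mul, ← Matrix.conjTranspose_mul, ← pow_two, siteOp_of_antisymm e12 he, h2,
      Matrix.adjugate_adjugate _ (by simp)] at h1
    simp only [Fintype.card_fin, Nat.sub_self, pow_zero, one_smul,
      Matrix.conjTranspose_conjTranspose] at h1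
    refine le_of_sq_le_sq ?_ (by have := siteNorm_nonneg T; positivity)
    nlinarith
  have hPe : siteOp (s (q + 1)) (1 - P) (siteOp (s (q + 2)) P e) = siteOp (s (q + 2)) P e := by
    rw [map_sub, map_one, _root_.sub_apply, one_apply_eq_self,
      siteOp_siteOp_of_antisymm e12 he, h.det_eq, zero_smul, sub_zero]
  refine ⟨siteOp (s (q + 2)) P e, hPe, ?_, ?_, ?_⟩
  · rw [siteOp_mul, h.mul_self]
  · have hT2 : IsUnit (T ^ 2).det := by rw [Matrix.det_pow]; exact hT.pow 2
    have h3 : e = siteOp (s q) (T ^ 2)⁻¹ (siteOp (s q) (T ^ 2) e) := by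
      rw [siteOp_mul, Matrix.nonsing_inv_mul _ hT2, map_one, one_apply_eq_self]
    calc _ ≤ ‖e‖ := norm_siteOp_le_of_proj h.conjTranspose_eq h.mul_self _ _
      _ ≤ siteNorm (T ^ 2)⁻¹ * ‖siteOp (s q) (T ^ 2) e‖ := by
        conv_lhs => rw [h3]
        exact norm_siteOp_le _ _ _
      _ ≤ siteNorm (T ^ 2)⁻¹ * (2 * siteNorm T * ‖x‖) :=
        mul_le_mul_of_nonneg_left hnorm (siteNorm_nonneg _)
      _ = _ := by ring
  · have : Tᴴ * (1 - P) = star μ • (1 - P) := by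
      rw [← h.compl_conjTranspose, ← Matrix.conjTranspose_mul, h.compl_conjTranspose, h.compl_mul,
        Matrix.conjTranspose_smul, h.compl_conjTranspose]
    rw [← map_smul, hx2, ← chainProj_siteOp hs (by omega) (by omega) (by omega),
      siteOp_commute e12.symm, ← hPe, siteOp_mul, this, map_smul, _root_.smul_apply]

theorem norm_siteOp_flip (h : IsEigenprojection T P F μ ν) (l : ι) (ξ : QubitSpace ι) :
    ‖siteOp l F ξ‖ = ‖siteOp l P ξ‖ := by
  have h1 := inner_self_eq_norm_sq_to_K (𝕜 := ℂ) (siteOp l F ξ)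
  rw [siteOp_inner, siteOp_mul, h.flip_mul,
    norm_sq_siteOp_of_proj h.conjTranspose_eq h.mul_self] at h1
  have h2 : ‖siteOp l P ξ‖ ^ 2 = ‖siteOp l F ξ‖ ^ 2 := by
    exact Complex.ofReal_injective (by push_cast; exact h1)
  exact ((sq_eq_sq₀ (norm_nonneg _) (norm_nonneg _)).1 h2).symm

/-- A duality argument: the lower bound of `norm_siteOp_compl_le_norm_chainProj` is tested on the
projection of `O'` applied to the vector to be estimated, and the hypothesis on `O` bounds the
extended projection occurring there. -/
theorem norm_apply_chainProj_le (hs : Set.InjOn s (Set.Iic N)) (hT : IsUnit T.det)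
    (h : IsEigenprojection T P F μ ν) (hpq : p ≤ q) (hN : q + 1 ≤ N)
    {O O' : QubitSpace ι →L[ℂ] QubitSpace ι} (hadj : ∀ x y, inner ℂ (O x) y = inner ℂ x (O' y))
    (hO : ∀ M x, O (siteOp (s (q + 1)) M x) = siteOp (s (q + 1)) M (O x))
    (hO' : ∀ M x, O' (siteOp (s (q + 1)) M x) = siteOp (s (q + 1)) M (O' x)) {B : ℝ} (hB : 0 ≤ B)
    (hOB : ∀ χ ∈ chainSpace T s p (q + 1), ‖siteOp (s (q + 1)) (1 - P) (O χ)‖ ≤ B * ‖χ‖)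
    {η : QubitSpace ι} (hη : siteOp (s q) (1 - P) η = η) (hη' : siteOp (s (q + 1)) P η = η) :
    ‖μ‖ * ‖O (chainProj T s p q η)‖ ≤ Real.sqrt 2 * siteNorm T * B * ‖η‖ := by
  have e1 : s q ≠ s (q + 1) := hs.ne (Set.mem_Iic.2 (by omega)) hN (by omega)
  have hproj := chainProj_siteOp (T := T) (p := p) (q := q) hs hN (by omega)
    (k := q + 1) (by omega)
  have ht := siteNorm_nonneg T
  -- The partial isometry turns `P` at site q+1 into `1 - P`. Both `O` and the projector commute
  -- with operators at this site, so no norm changes.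
  set ζ := siteOp (s (q + 1)) F η with hζ
  have hζ1 : ‖ζ‖ = ‖η‖ := by rw [hζ, norm_siteOp_flip h, hη']
  have hζ2 : ‖O (chainProj T s p q ζ)‖ = ‖O (chainProj T s p q η)‖ := by
    rw [hζ, hproj, hO, norm_siteOp_flip h, ← hO, ← hproj, hη']
  have hζ3 : siteOp (s (q + 1)) (1 - P) ζ = ζ := by rw [hζ, siteOp_mul, h.compl_flip]
  have hζ4 : siteOp (s q) (1 - P) ζ = ζ := by rw [hζ, siteOp_commute e1, hη]
  rw [← hζ1, ← hζ2]
  set y := O (chainProj T s p q ζ) with hy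
  have hy1 : siteOp (s (q + 1)) (1 - P) y = y := by rw [hy, ← hO, ← hproj, hζ3]
  set φ := chainProj T s p q (O' y) with hφ
  have hφ1 : siteOp (s (q + 1)) (1 - P) φ = φ := by rw [hφ, ← hproj, ← hO', hy1]
  have h1 := norm_siteOp_compl_le_norm_chainProj hs hT h hpq hN (chainProj_mem (O' y)) hφ1
  rw [chainProj_chainProj le_rfl (Nat.le_succ q)] at h1
  have h2 : ‖chainProj T s p (q + 1) (O' y)‖ ≤ B * ‖y‖ := by
    set z := chainProj T s p (q + 1) (O' y) with hz
    have hz1 : z ∈ chainSpace T s p (q + 1) := chainProj_mem _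
    have h3 : ‖z‖ * ‖z‖ ≤ B * ‖y‖ * ‖z‖ := by
      have h4 : inner ℂ z z = inner ℂ (siteOp (s (q + 1)) (1 - P) (O z)) y := by
        conv_lhs => rw [hz]
        rw [inner_chainProj hz1, ← hadj, siteOp_inner, h.compl_conjTranspose, hy1]
      calc ‖z‖ * ‖z‖ = ‖inner ℂ z z‖ := (norm_inner_self z).symm
        _ ≤ ‖siteOp (s (q + 1)) (1 - P) (O z)‖ * ‖y‖ := by rw [h4]; exact norm_inner_le_norm _ _
        _ ≤ B * ‖z‖ * ‖y‖ := mul_le_mul_of_nonneg_right (hOB z hz1) (norm_nonneg _)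
        _ = _ := by ring
    rcases (norm_nonneg z).eq_or_lt with h4 | h4
    · rw [← h4]; positivity
    · exact le_of_mul_le_mul_right h3 h4
  have h3 : ‖μ‖ * ‖siteOp (s q) (1 - P) φ‖ ≤ Real.sqrt 2 * siteNorm T * (B * ‖y‖) := by
    refine le_of_sq_le_sq ?_ (by positivity)
    rw [mul_pow, mul_pow, mul_pow, Real.sq_sqrt (by norm_num)]
    refine h1.trans ?_
    gcongr
  have h4 : ‖y‖ * ‖y‖ ≤ ‖ζ‖ * ‖siteOp (s q) (1 - P) φ‖ := by
    have h5 : inner ℂ y y = inner ℂ ζ (siteOp (s q) (1 - P) φ) := by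
      have h6 := siteOp_inner (s q) (1 - P) ζ φ
      rw [h.compl_conjTranspose, hζ4] at h6
      rw [← h6, hφ, chainProj, ← Submodule.inner_starProjection_left_eq_right, ← hadj]
      rfl
    calc ‖y‖ * ‖y‖ = ‖inner ℂ y y‖ := (norm_inner_self y).symm
      _ ≤ _ := by rw [h5]; exact norm_inner_le_norm _ _
  rcases (norm_nonneg y).eq_or_lt with h5 | h5
  · rw [← h5]; simp only [mul_zero]; positivity
  · refine le_of_mul_le_mul_right ?_ h5
    calc ‖μ‖ * ‖y‖ * ‖y‖ = ‖μ‖ * (‖y‖ * ‖y‖) := by ring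
      _ ≤ ‖μ‖ * (‖ζ‖ * ‖siteOp (s q) (1 - P) φ‖) := by gcongr
      _ = ‖ζ‖ * (‖μ‖ * ‖siteOp (s q) (1 - P) φ‖) := by ring
      _ ≤ ‖ζ‖ * (Real.sqrt 2 * siteNorm T * (B * ‖y‖)) := by gcongr
      _ = _ := by ring

/-- A state of the chain space orthogonal to the extended chain space and projected to `P` on the
additional site inherits localization estimates from the extended chain space. -/
theorem norm_apply_siteOp_le (hs : Set.InjOn s (Set.Iic N)) (hT : IsUnit T.det)
    (h : IsEigenprojection T P F μ ν) (hpq : p ≤ q) (hN : q + 2 ≤ N)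
    {O O' : QubitSpace ι →L[ℂ] QubitSpace ι} (hadj : ∀ x y, inner ℂ (O x) y = inner ℂ x (O' y))
    (hO : ∀ M x, O (siteOp (s (q + 2)) M x) = siteOp (s (q + 2)) M (O x))
    (hO' : ∀ M x, O' (siteOp (s (q + 2)) M x) = siteOp (s (q + 2)) M (O' x)) {B : ℝ} (hB : 0 ≤ B)
    (hOB : ∀ χ ∈ chainSpace T s p (q + 2), ‖siteOp (s (q + 2)) (1 - P) (O χ)‖ ≤ B * ‖χ‖)
    {x : QubitSpace ι} (hx : x ∈ chainSpace T s p (q + 1))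
    (hx' : ∀ w ∈ chainSpace T s p (q + 2), inner ℂ w x = 0) :
    ‖O (siteOp (s (q + 2)) P x)‖ ≤ localizationConst T * B * ‖x‖ := by
  obtain ⟨η, h1, h2, h3, h4⟩ := exists_eq_chainProj hs hT h hpq hN hx hx'
  have ht := siteNorm_nonneg T
  -- The factor `star μ` carried by the representation of `x` supplies the ‖μ‖ on the left of
  -- `norm_apply_chainProj_le`.
  rw [h4, map_smul, norm_smul, norm_star]
  refine (norm_apply_chainProj_le hs hT h (hpq.trans (Nat.le_succ q)) hN hadj hO hO' hB hOB
    h1 h2).trans ?_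
  unfold localizationConst
  calc _ ≤ Real.sqrt 2 * siteNorm T * B * (2 * siteNorm T * siteNorm (T ^ 2)⁻¹ * ‖x‖) := by gcongr
    _ = _ := by ring

end Localization

/-! ### Products of one-site projections over a block -/

section Products

variable {ι : Type} [Fintype ι] [DecidableEq ι] {W P : Matrix (Fin 2) (Fin 2) ℂ} {s : ℕ → ι}
  {N j n : ℕ} {c : ℝ}

/-- The product of the one-site operators `W` at the `n` sites `s j, …, s (j + n - 1)`. -/
def prodOp (s : ℕ → ι) (W : Matrix (Fin 2) (Fin 2) ℂ) (j : ℕ) :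
    ℕ → QubitSpace ι →L[ℂ] QubitSpace ι
  | 0 => 1
  | n + 1 => siteOp (s (j + n)) W * prodOp s W j n

theorem prodOp_succ_apply (ξ : QubitSpace ι) :
    prodOp s W j (n + 1) ξ = siteOp (s (j + n)) W (prodOp s W j n ξ) := rfl

theorem prodOp_zero_apply (ξ : QubitSpace ι) : prodOp s W j 0 ξ = ξ := rfl

theorem prodOp_siteOp (hs : Set.InjOn s (Set.Iic N)) (hn : j + n ≤ N + 1) {k : ℕ} (hk : k ≤ N)
    (h : k < j ∨ j + n ≤ k) (M : Matrix (Fin 2) (Fin 2) ℂ) (ξ : QubitSpace ι) :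
    prodOp s W j n (siteOp (s k) M ξ) = siteOp (s k) M (prodOp s W j n ξ) := by
  induction n with
  | zero => rfl
  | succ n ih =>
    have e : s (j + n) ≠ s k := hs.ne (Set.mem_Iic.2 (by omega)) hk (by omega)
    rw [prodOp_succ_apply, prodOp_succ_apply, ih (by omega) (by omega), siteOp_commute e]

theorem prodOp_inner (hs : Set.InjOn s (Set.Iic N)) (hn : j + n ≤ N + 1) (hW : Wᴴ = W)
    (ξ η : QubitSpace ι) :
    inner ℂ (prodOp s W j n ξ) η = inner ℂ ξ (prodOp s W j n η) := by
  induction n generalizing ξ η with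
  | zero => rfl
  | succ n ih =>
    rw [prodOp_succ_apply, prodOp_succ_apply, siteOp_inner, ih (by omega), hW,
      prodOp_siteOp hs (by omega) (by omega) (by omega)]

theorem prodOp_succ_apply' (hs : Set.InjOn s (Set.Iic N)) (hn : j + (n + 1) ≤ N + 1)
    (ξ : QubitSpace ι) :
    prodOp s W j (n + 1) ξ = siteOp (s j) W (prodOp s W (j + 1) n ξ) := by
  induction n with
  | zero => rfl
  | succ n ih =>
    have e : s (j + (n + 1)) ≠ s j :=
      hs.ne (Set.mem_Iic.2 (by omega)) (Set.mem_Iic.2 (by omega)) (by omega)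
    rw [prodOp_succ_apply, ih (by omega), prodOp_succ_apply, siteOp_commute e,
      show j + 1 + n = j + (n + 1) by omega]

theorem prodOp_reverse (hs : Set.InjOn s (Set.Iic N)) {a : ℕ} (h : a + n + j = N + 1)
    (ξ : QubitSpace ι) :
    prodOp (fun i => s (N - i)) W a n ξ = prodOp s W j n ξ := by
  induction n generalizing j with
  | zero => rfl
  | succ n ih =>
    rw [prodOp_succ_apply' hs (by omega), prodOp_succ_apply, ih (by omega : a + n + (j + 1) = _),
      show N - (a + n) = j by omega]

theorem norm_prodOp_le (hW : Wᴴ = W) (hW' : W * W = W) (ξ : QubitSpace ι) :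
    ‖prodOp s W j n ξ‖ ≤ ‖ξ‖ := by
  induction n with
  | zero => rfl
  | succ n ih => exact (norm_siteOp_le_of_proj hW hW' _ _).trans ih

/-- Each new projection contracts the error made so far and adds the error of its own site. -/
theorem norm_sub_prodOp_le (hW : Wᴴ = W) (hW' : W * W = W) (ξ : QubitSpace ι) :
    ‖ξ - prodOp s W j n ξ‖ ≤ ∑ i ∈ Finset.range n, ‖siteOp (s (j + i)) (1 - W) ξ‖ := by
  induction n with
  | zero => simp [prodOp_zero_apply]
  | succ n ih =>
    rw [Finset.sum_range_succ]
    have h : ξ - prodOp s W j (n + 1) ξ = siteOp (s (j + n)) W (ξ - prodOp s W j n ξ) +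
        siteOp (s (j + n)) (1 - W) ξ := by
      rw [prodOp_succ_apply, map_sub (siteOp _ _), map_sub (siteOp _), map_one, _root_.sub_apply,
        one_apply_eq_self]
      abel
    rw [h]
    exact (norm_add_le _ _).trans (add_le_add
      ((norm_siteOp_le_of_proj hW hW' _ _).trans ih) le_rfl)

/-- The relation `P W P = c² P` says that `W P` is c times an isometry on the range of `P`. -/
theorem norm_siteOp_siteOp_le (hW : Wᴴ = W) (hW' : W * W = W) (hP : Pᴴ = P) (hP' : P * P = P)
    (hc : 0 ≤ c) (h : P * W * P = ((c ^ 2 : ℝ) : ℂ) • P) (l : ι) (ξ : QubitSpace ι) :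
    ‖siteOp l W (siteOp l P ξ)‖ ≤ c * ‖ξ‖ := by
  have h1 := norm_sq_siteOp_of_proj hW hW' l (siteOp l P ξ)
  rw [siteOp_inner, siteOp_mul, siteOp_mul, hP, h, map_smul, _root_.smul_apply,
    inner_smul_right, norm_sq_siteOp_of_proj hP hP'] at h1
  have h2 : (c * ‖siteOp l P ξ‖) ^ 2 = ‖siteOp l W (siteOp l P ξ)‖ ^ 2 := by
    rw [mul_pow]
    exact Complex.ofReal_injective (by push_cast at h1 ⊢; exact h1)
  have h3 := (sq_eq_sq₀ (by positivity) (norm_nonneg _)).1 h2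
  rw [← h3]
  exact mul_le_mul_of_nonneg_left (norm_siteOp_le_of_proj hP hP' _ _) hc

theorem norm_prodOp_prodOp_le (hs : Set.InjOn s (Set.Iic N)) (hn : j + n ≤ N + 1)
    (hW : Wᴴ = W) (hW' : W * W = W) (hP : Pᴴ = P) (hP' : P * P = P)
    (hc : 0 ≤ c) (h : P * W * P = ((c ^ 2 : ℝ) : ℂ) • P) (ξ : QubitSpace ι) :
    ‖prodOp s W j n (prodOp s P j n ξ)‖ ≤ c ^ n * ‖ξ‖ := by
  induction n with
  | zero => simp [prodOp_zero_apply]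
  | succ n ih =>
    rw [prodOp_succ_apply, prodOp_succ_apply, prodOp_siteOp hs (by omega) (by omega) (by omega)]
    refine (norm_siteOp_siteOp_le hW hW' hP hP' hc h _ _).trans ?_
    rw [pow_succ', mul_assoc]
    exact mul_le_mul_of_nonneg_left (ih (by omega)) hc

end Products

/-! ### Mutual exclusion of the two complements, and localization on a block -/

section Exclusion

variable {ι : Type} [Fintype ι] [DecidableEq ι] {T P F W F' : Matrix (Fin 2) (Fin 2) ℂ} {s : ℕ → ι}
  {N p q : ℕ} {μ ν : ℂ} {ρ c : ℝ}

/-- In `T_i ^ m χ` the factor `1 - W` at i evaluates the power to ν^m. After the exchange, which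
fixes this state, `1 - P` stands at i and gives μ^m. -/
theorem smul_siteOp_compl_siteOp_compl (h : IsEigenprojection T P F μ ν)
    (h' : IsEigenprojection T W F' ν μ) {i l : ι} (hil : i ≠ l) (m : ℕ) {χ : QubitSpace ι}
    (hχ : swapOp i l (siteOp i (T ^ m) χ) = siteOp i (T ^ m) χ) :
    ν ^ m • siteOp i (1 - W) (siteOp l (1 - P) χ) =
      μ ^ m • swapOp i l (siteOp l (1 - W) (siteOp i (1 - P) χ)) := by
  have h1 : ν ^ m • siteOp i (1 - W) (siteOp l (1 - P) χ) =
      siteOp i (1 - W) (siteOp l (1 - P) (siteOp i (T ^ m) χ)) := by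
    rw [siteOp_commute hil.symm (1 - P), siteOp_mul, h'.compl_mul_pow, map_smul]
    rfl
  rw [h1, ← hχ, ← swapOp_siteOp_left, ← swapOp_siteOp_right, siteOp_mul, h.compl_mul_pow,
    map_smul]
  simp only [_root_.smul_apply, map_smul]

/-- On the chain space, the states complementary to `W` on the left and complementary to `P` on the
right exclude each other, up to an exponentially small error. -/
theorem norm_siteOp_compl_siteOp_compl_le (hs : Set.InjOn s (Set.Iic N))
    (h : IsEigenprojection T P F μ ν) (h' : IsEigenprojection T W F' ν μ)
    (hν : ν ≠ 0) (hρ : ‖μ‖ = ρ * ‖ν‖) (hc : 0 ≤ c) (hc1 : c < 1)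
    (hPW : P * W * P = ((c ^ 2 : ℝ) : ℂ) • P) {i m : ℕ} (hm : 0 < m) (hN : i + m ≤ N)
    {χ : QubitSpace ι} (hχ : χ ∈ chainSpace T s i (i + m)) :
    ‖siteOp (s i) (1 - W) (siteOp (s (i + m)) (1 - P) χ)‖ ≤ ρ ^ m * ‖χ‖ := by
  have hν' : 0 < ‖ν‖ := norm_pos_iff.2 hν
  have key : ∀ {i m : ℕ}, 0 < m → i + m ≤ N → ∀ {χ : QubitSpace ι},
      swapOp (s i) (s (i + m)) (siteOp (s i) (T ^ m) χ) = siteOp (s i) (T ^ m) χ →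
      ‖siteOp (s i) (1 - W) (siteOp (s (i + m)) (1 - P) χ)‖ ≤ ρ ^ m * ‖χ‖ := by
    intro i m hm hN χ hχ
    have e : s i ≠ s (i + m) := hs.ne (Set.mem_Iic.2 (by omega)) hN (by omega)
    have h1 := congrArg norm (smul_siteOp_compl_siteOp_compl h h' e m hχ)
    rw [norm_smul, norm_smul, norm_swapOp, norm_pow, norm_pow, hρ, mul_pow] at h1
    refine le_of_mul_le_mul_left ?_ (pow_pos hν' m)
    have h2 : ‖siteOp (s (i + m)) (1 - W) (siteOp (s i) (1 - P) χ)‖ ≤ ‖χ‖ :=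
      (norm_siteOp_le_of_proj h'.compl_conjTranspose h'.compl_mul_self _ _).trans
        (norm_siteOp_le_of_proj h.compl_conjTranspose h.compl_mul_self _ _)
    have hρ0 : 0 ≤ ρ := by
      by_contra hneg
      have : ρ * ‖ν‖ < 0 := mul_neg_of_neg_of_pos (not_le.1 hneg) hν'
      linarith [norm_nonneg μ]
    rw [h1]
    calc _ ≤ ρ ^ m * ‖ν‖ ^ m * ‖χ‖ := by gcongr
      _ = _ := by ring
  -- For μ = 0 the ring cannot be closed. Adjacent sites exclude exactly; for larger m, exclusion
  -- with the site i+1 from either end leaves a state in the ranges of both `P` and `W` there, which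
  -- is zero since c < 1.
  by_cases hμ : μ = 0
  · have hρ0 : ρ = 0 := by
      rw [hμ, norm_zero] at hρ
      exact (mul_eq_zero.1 hρ.symm).resolve_right hν'.ne'
    rw [hρ0, zero_pow hm.ne', zero_mul, norm_le_zero_iff]
    have adj : ∀ {i : ℕ} {χ : QubitSpace ι}, i + 1 ≤ N → χ ∈ chainSpace T s i (i + 1) →
        siteOp (s i) (1 - W) (siteOp (s (i + 1)) (1 - P) χ) = 0 := by
      intro i χ hi hχ
      have := key (i := i) (m := 1) Nat.one_pos hi (by simpa using hχ i le_rfl (by omega))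
      rwa [hρ0, pow_one, zero_mul, norm_le_zero_iff] at this
    induction m generalizing i with
    | zero => exact absurd hm (lt_irrefl 0)
    | succ m ih =>
      rcases Nat.eq_zero_or_pos m with rfl | hm'
      · exact adj hN hχ
      have h1 := adj (by omega) (chainSpace_mono (T := T) (s := s) le_rfl
        (by omega : i + 1 ≤ i + (m + 1)) hχ)
      have h2 := ih hm' (i := i + 1) (by omega)
        (chainSpace_mono (by omega) (by omega : i + 1 + m ≤ i + (m + 1)) hχ)
      rw [show i + 1 + m = i + (m + 1) by omega] at h2
      have e1 : s i ≠ s (i + 1) :=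
        hs.ne (Set.mem_Iic.2 (by omega)) (Set.mem_Iic.2 (by omega)) (by omega)
      have e2 : s i ≠ s (i + (m + 1)) := hs.ne (Set.mem_Iic.2 (by omega)) hN (by omega)
      have e3 : s (i + 1) ≠ s (i + (m + 1)) := hs.ne (Set.mem_Iic.2 (by omega)) hN (by omega)
      set y := siteOp (s i) (1 - W) (siteOp (s (i + (m + 1))) (1 - P) χ) with hy
      have h3 : siteOp (s (i + 1)) (1 - P) y = 0 := by
        rw [hy, siteOp_commute e1.symm, siteOp_commute e3, siteOp_commute e2, h1, map_zero]
      have h4 : siteOp (s (i + 1)) (1 - W) y = 0 := by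
        rw [hy, siteOp_commute e1.symm, h2, map_zero]
      have h5 := siteOp_add_compl P (s (i + 1)) y
      have h6 := siteOp_add_compl W (s (i + 1)) y
      rw [h3, add_zero] at h5
      rw [h4, add_zero] at h6
      have h7 := norm_siteOp_siteOp_le h'.conjTranspose_eq h'.mul_self h.conjTranspose_eq
        h.mul_self hc hPW (s (i + 1)) y
      rw [← h5, ← h6] at h7
      have h8 : ‖y‖ = 0 := by nlinarith [norm_nonneg y]
      exact norm_eq_zero.1 h8
  · have hT : IsUnit T.det := by
      rw [h.det_matrix]
      exact (mul_ne_zero hμ hν).isUnit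
    exact key hm hN (swapOp_siteOp_pow hs hT m hN hχ)

theorem sum_range_pow_sub_le (h0 : 0 ≤ ρ) (h1 : ρ < 1) (k n : ℕ) :
    ∑ i ∈ Finset.range n, ρ ^ (k + (n - 1 - i)) ≤ ρ ^ k / (1 - ρ) := by
  rw [Finset.sum_range_reflect (fun i => ρ ^ (k + i))]
  simp only [pow_add, ← Finset.mul_sum]
  rw [div_eq_mul_inv, ← tsum_geometric_of_lt_one h0 h1]
  exact mul_le_mul_of_nonneg_left ((summable_geometric_of_lt_one h0 h1).sum_le_tsum _
    fun _ _ => pow_nonneg h0 _) (pow_nonneg h0 k)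

/-- The data of the two eigenprojections of `T` with eigenvalues of different modulus: `P` belongs
to the larger eigenvalue `ν`, `W` to the smaller one `μ`, with `ρ = ‖μ‖ / ‖ν‖` and overlap `c`. -/
structure IsSpectralPair (T P F W F' : Matrix (Fin 2) (Fin 2) ℂ) (μ ν : ℂ) (ρ c : ℝ) :
    Prop where
  large : IsEigenprojection T P F μ ν
  small : IsEigenprojection T W F' ν μ
  ne_zero : ν ≠ 0
  norm_eq : ‖μ‖ = ρ * ‖ν‖
  ratio_nonneg : 0 ≤ ρ
  ratio_lt_one : ρ < 1
  overlap_nonneg : 0 ≤ c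
  overlap_lt_one : c < 1
  mul_mul_eq : P * W * P = ((c ^ 2 : ℝ) : ℂ) • P
  mul_mul_eq' : W * P * W = ((c ^ 2 : ℝ) : ℂ) • W

theorem IsSpectralPair.adjugate (h : IsSpectralPair T P F W F' μ ν ρ c) :
    IsSpectralPair T.adjugate W F' P F μ ν ρ c :=
  ⟨h.small.adjugate, h.large.adjugate, h.ne_zero, h.norm_eq, h.ratio_nonneg, h.ratio_lt_one,
    h.overlap_nonneg, h.overlap_lt_one, h.mul_mul_eq', h.mul_mul_eq⟩

/-- The block ends at distance k from l, so the exclusion errors of its sites sum to a geometric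
tail. -/
theorem norm_compl_sub_prodOp_le (hs : Set.InjOn s (Set.Iic N))
    (h : IsSpectralPair T P F W F' μ ν ρ c) {j n k l : ℕ} (hk : 0 < k) (hj : p ≤ j)
    (hjl : j + n + k = l + 1) (hl : l ≤ q) (hq : q ≤ N)
    {χ : QubitSpace ι} (hχ : χ ∈ chainSpace T s p q) :
    ‖siteOp (s l) (1 - P) χ - prodOp s W j n (siteOp (s l) (1 - P) χ)‖ ≤
      ρ ^ k / (1 - ρ) * ‖χ‖ := by
  refine (norm_sub_prodOp_le h.small.conjTranspose_eq h.small.mul_self _).trans ?_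
  refine (Finset.sum_le_sum (g := fun i => ρ ^ (k + (n - 1 - i)) * ‖χ‖) fun i hi => ?_).trans ?_
  · rw [Finset.mem_range] at hi
    have := norm_siteOp_compl_siteOp_compl_le hs h.large h.small h.ne_zero h.norm_eq
      h.overlap_nonneg h.overlap_lt_one h.mul_mul_eq (i := j + i) (m := k + (n - 1 - i))
      (by omega) (by omega) (chainSpace_mono (by omega) (by omega) hχ)
    rwa [show j + i + (k + (n - 1 - i)) = l by omega] at this
  · rw [← Finset.sum_mul]
    exact mul_le_mul_of_nonneg_right (sum_range_pow_sub_le h.ratio_nonneg h.ratio_lt_one k n)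
      (norm_nonneg χ)

/-- `P` at the free end is not covered by exclusion. Orthogonality to the extended chain space
transfers the estimate from there, with `O` the deviation from the product of `W`. -/
theorem norm_siteOp_sub_prodOp_le (hs : Set.InjOn s (Set.Iic N))
    (h : IsSpectralPair T P F W F' μ ν ρ c) {j n k : ℕ} (hk : 0 < k) (hj : p ≤ j)
    (hpq : p + 2 ≤ q) (hq : q ≤ N) (hjq : j + n + k = q + 1)
    {x : QubitSpace ι} (hx : x ∈ chainSpace T s p (q - 1))
    (hx' : ∀ w ∈ chainSpace T s p q, inner ℂ w x = 0) :
    ‖siteOp (s q) P x - prodOp s W j n (siteOp (s q) P x)‖ ≤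
      localizationConst T * (ρ ^ k / (1 - ρ)) * ‖x‖ := by
  obtain ⟨r, rfl⟩ : ∃ r, q = r + 2 := ⟨q - 2, by omega⟩
  have hB : 0 ≤ ρ ^ k / (1 - ρ) :=
    div_nonneg (pow_nonneg h.ratio_nonneg k) (by linarith [h.ratio_lt_one])
  by_cases hμ : μ = 0
  · have h1 : siteOp (s (r + 2)) P x = 0 := by
      have e : s (r + 1) ≠ s (r + 2) := hs.ne (Set.mem_Iic.2 (by omega)) hq (by omega)
      -- If μ = 0, `P` at the new site satisfies the new bond by itself, because the adjugate of `T`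
      -- kills it. The vector then lies in the space to which `x` is orthogonal, so it vanishes.
      have h2 : siteOp (s (r + 2)) P x ∈ chainSpace T s p (r + 2) := by
        intro i h1 h2
        rcases Nat.lt_or_eq_of_le (Nat.lt_succ_iff.1 h2) with h3 | rfl
        · exact siteOp_mem_chainSpace hs hq (by omega) (by omega) P hx i h1 (by omega)
        · have := sub_swapOp_siteOp e T (siteOp (s (r + 2)) P x)
          rw [siteOp_mul _ T.adjugate, h.large.adjugate_mul, hμ, zero_smul, map_zero] at this
          simp only [_root_.zero_apply, map_zero, sub_zero] at this
          exact (sub_eq_zero.1 this).symm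
      have h3 := hx' _ h2
      rw [siteOp_inner, h.large.conjTranspose_eq,
        norm_sq_siteOp_of_proj h.large.conjTranspose_eq h.large.mul_self] at h3
      simpa using h3
    rw [h1, map_zero, sub_zero, norm_zero]
    have := localizationConst_nonneg T
    positivity
  · have hT : IsUnit T.det := by
      rw [h.large.det_matrix]
      exact (mul_ne_zero hμ h.ne_zero).isUnit
    have hO : ∀ M x, (1 - prodOp s W j n) (siteOp (s (r + 2)) M x) =
        siteOp (s (r + 2)) M ((1 - prodOp s W j n) x) := by
      intro M x
      simp only [_root_.sub_apply, one_apply_eq_self, map_sub]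
      rw [prodOp_siteOp hs (by omega) hq (by omega)]
    refine norm_apply_siteOp_le (O := 1 - prodOp s W j n) (O' := 1 - prodOp s W j n) hs hT
      h.large (by omega) hq ?_ hO hO hB ?_ hx hx'
    · intro x y
      simp only [_root_.sub_apply, one_apply_eq_self, inner_sub_left, inner_sub_right]
      rw [prodOp_inner hs (by omega) h.small.conjTranspose_eq]
    · intro χ hχ
      rw [← hO]
      exact norm_compl_sub_prodOp_le hs h hk hj (by omega) le_rfl hq hχ

/-- Moving `T` to the other end of each bond makes it the adjugate. Reflection thus exchanges the
roles of `P` and `W`, and the left-hand estimates follow from the right-hand ones. -/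
theorem chainSpace_reverse (hs : Set.InjOn s (Set.Iic N)) (hpq : p ≤ q) (hq : q ≤ N) :
    chainSpace T.adjugate (fun i => s (N - i)) (N - q) (N - p) = chainSpace T s p q := by
  have key : ∀ i, i + 1 ≤ N → ∀ ξ : QubitSpace ι,
      (swapOp (s i) (s (i + 1)) (siteOp (s i) T ξ) = siteOp (s i) T ξ ↔
      swapOp (s (i + 1)) (s i) (siteOp (s (i + 1)) T.adjugate ξ) =
        siteOp (s (i + 1)) T.adjugate ξ) := by
    intro i hi ξ
    have e : s i ≠ s (i + 1) := hs.ne (Set.mem_Iic.2 (by omega)) hi (by omega)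
    have := sub_swapOp_siteOp e T ξ
    rw [swapOp_comm (s (i + 1)), eq_comm, ← sub_eq_zero, this, sub_eq_zero, eq_comm]
  ext ξ
  constructor
  · intro h i h1 h2
    rw [key i (by omega)]
    have := h (N - (i + 1)) (by omega) (by omega)
    simp only [show N - (N - (i + 1)) = i + 1 by omega,
      show N - (N - (i + 1) + 1) = i by omega] at this
    exact this
  · intro h i h1 h2
    have := (key (N - (i + 1)) (by omega) ξ).1 (h (N - (i + 1)) (by omega) (by omega))
    rw [show N - (i + 1) + 1 = N - i by omega] at this
    exact this

theorem injOn_reverse {κ : Type} {s : ℕ → κ} (hs : Set.InjOn s (Set.Iic N)) :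
    Set.InjOn (fun i => s (N - i)) (Set.Iic N) := by
  intro a ha b hb hab
  have := hs (Set.mem_Iic.2 (Nat.sub_le N a)) (Set.mem_Iic.2 (Nat.sub_le N b)) hab
  rw [Set.mem_Iic] at ha hb
  omega

theorem norm_compl_sub_prodOp_le_left (hs : Set.InjOn s (Set.Iic N))
    (h : IsSpectralPair T P F W F' μ ν ρ c) {j n k : ℕ} (hk : 0 < k)
    (hj : p + k = j) (hjq : j + n ≤ q + 1) (hpq : p ≤ q) (hq : q ≤ N)
    {χ : QubitSpace ι} (hχ : χ ∈ chainSpace T s p q) :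
    ‖siteOp (s p) (1 - W) χ - prodOp s P j n (siteOp (s p) (1 - W) χ)‖ ≤
      ρ ^ k / (1 - ρ) * ‖χ‖ := by
  rw [← chainSpace_reverse hs hpq hq] at hχ
  have := norm_compl_sub_prodOp_le (injOn_reverse hs) h.adjugate (j := N + 1 - j - n) (n := n)
    (l := N - p) hk (by omega) (by omega) le_rfl (by omega) hχ
  rw [prodOp_reverse hs (by omega : N + 1 - j - n + n + j = N + 1)] at this
  simpa only [show N - (N - p) = p by omega] using this

theorem norm_siteOp_sub_prodOp_le_left (hs : Set.InjOn s (Set.Iic N))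
    (h : IsSpectralPair T P F W F' μ ν ρ c) {j n k : ℕ} (hk : 0 < k) (hj : p + k = j)
    (hpq : p + 2 ≤ q) (hq : q ≤ N) (hjq : j + n ≤ q + 1)
    {y : QubitSpace ι} (hy : y ∈ chainSpace T s (p + 1) q)
    (hy' : ∀ w ∈ chainSpace T s p q, inner ℂ w y = 0) :
    ‖siteOp (s p) W y - prodOp s P j n (siteOp (s p) W y)‖ ≤
      localizationConst T.adjugate * (ρ ^ k / (1 - ρ)) * ‖y‖ := by
  rw [← chainSpace_reverse hs (by omega) hq] at hy hy'
  have := norm_siteOp_sub_prodOp_le (injOn_reverse hs) h.adjugate (j := N + 1 - j - n) (n := n)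
    (p := N - q) (q := N - p) hk (by omega) (by omega) (by omega) (by omega)
    (by rwa [show N - p - 1 = N - (p + 1) by omega]) hy'
  rw [prodOp_reverse hs (by omega : N + 1 - j - n + n + j = N + 1)] at this
  simpa only [show N - (N - p) = p by omega] using this

end Exclusion

/-! ### Reducing the operator norm to overlaps of orthogonal parts -/

section Projections

variable {E : Type} [NormedAddCommGroup E] [InnerProductSpace ℂ E] [FiniteDimensional ℂ E]

/-- With `y = Y w - Z w`, the operator `X Y - Z` sends w to `z = X y`. Both y and z are orthogonal
to `Z`, and ‖z‖² = ⟨z, y⟩. -/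
theorem norm_starProjection_sub_mul_le {X Y Z : Submodule ℂ E} (hX : Z ≤ X) (hY : Z ≤ Y) {ε : ℝ}
    (hε : 0 ≤ ε) (h : ∀ x ∈ X, (∀ z ∈ Z, inner ℂ z x = 0) → ∀ y ∈ Y, (∀ z ∈ Z, inner ℂ z y = 0) →
      ‖inner ℂ x y‖ ≤ ε * ‖x‖ * ‖y‖) :
    ‖Z.starProjection - X.starProjection * Y.starProjection‖ ≤ ε := by
  have hinner : ∀ (U : Submodule ℂ E) (w : E), ∀ z ∈ U, inner ℂ z (U.starProjection w) =
      inner ℂ z w := by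
    intro U w z hz
    rw [← Submodule.inner_starProjection_left_eq_right, Submodule.starProjection_eq_self_iff.2 hz]
  rw [← norm_neg, neg_sub]
  refine ContinuousLinearMap.opNorm_le_bound _ hε fun w => ?_
  set y := Y.starProjection w - Z.starProjection w with hy
  have hyY : y ∈ Y := sub_mem (Submodule.starProjection_apply_mem _ _)
    (hY (Submodule.starProjection_apply_mem _ _))
  have hyZ : ∀ z ∈ Z, inner ℂ z y = 0 := by
    intro z hz
    rw [hy, inner_sub_right, hinner Y w z (hY hz), hinner Z w z hz, sub_self]
  have hyw : ‖y‖ ≤ ‖w‖ := by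
    have h1 : inner ℂ y y = inner ℂ y w := by
      have h2 : inner ℂ y (Z.starProjection w) = 0 := by
        rw [← inner_conj_symm, hyZ _ (Submodule.starProjection_apply_mem _ _), map_zero]
      calc inner ℂ y y = inner ℂ y (Y.starProjection w) - inner ℂ y (Z.starProjection w) := by
            rw [← inner_sub_right]
        _ = inner ℂ y w := by rw [h2, sub_zero, hinner Y w _ hyY]
    have h2 : ‖y‖ * ‖y‖ ≤ ‖w‖ * ‖y‖ := by
      have h3 := norm_inner_le_norm (𝕜 := ℂ) y w
      rw [← h1, inner_self_eq_norm_sq_to_K, norm_pow, RCLike.norm_ofReal, abs_norm] at h3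
      nlinarith
    rcases (norm_nonneg y).eq_or_lt with h4 | h4
    · rw [← h4]; exact norm_nonneg _
    · exact le_of_mul_le_mul_right h2 h4
  have hz : (X.starProjection * Y.starProjection - Z.starProjection) w = X.starProjection y := by
    rw [hy, map_sub, Submodule.starProjection_eq_self_iff.2
      (hX (Submodule.starProjection_apply_mem Z w))]
    rfl
  rw [hz]
  set z := X.starProjection y with hz'
  have hzX : z ∈ X := Submodule.starProjection_apply_mem _ _
  have h1 := h z hzX (fun u hu => by rw [hz', hinner X y u (hX hu), hyZ u hu]) y hyY hyZ
  have h2 : inner ℂ z z = inner ℂ z y := by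
    conv_lhs => rw [hz', hinner X y _ hzX]
  rw [← h2, inner_self_eq_norm_sq_to_K, norm_pow, RCLike.norm_ofReal, abs_norm] at h1
  have h3 : ‖z‖ * ‖z‖ ≤ ε * ‖w‖ * ‖z‖ := by
    have : ε * ‖z‖ * ‖y‖ ≤ ε * ‖z‖ * ‖w‖ := by gcongr
    nlinarith
  rcases (norm_nonneg z).eq_or_lt with h4 | h4
  · rw [← h4]; positivity
  · exact le_of_mul_le_mul_right h3 h4

end Projections

/-! ### Overlap of the two one-site-shifted ground spaces -/

section Overlap

variable {ι : Type} [Fintype ι] [DecidableEq ι] {T P F W F' : Matrix (Fin 2) (Fin 2) ℂ} {s : ℕ → ι}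
  {N p q : ℕ} {μ ν : ℂ} {ρ c : ℝ}

theorem norm_inner_le_of_prodOp (hs : Set.InjOn s (Set.Iic N))
    (h : IsSpectralPair T P F W F' μ ν ρ c) {j n : ℕ} (hn : j + n ≤ N + 1)
    {a b : QubitSpace ι} {α β : ℝ} (ha : ‖a - prodOp s P j n a‖ ≤ α)
    (hb : ‖b - prodOp s W j n b‖ ≤ β) :
    ‖inner ℂ b a‖ ≤ β * ‖a‖ + ‖b‖ * α + c ^ n * ‖b‖ * ‖a‖ := by
  have h1 : inner ℂ b a = inner ℂ (b - prodOp s W j n b) a +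
      inner ℂ (prodOp s W j n b) (a - prodOp s P j n a) +
      inner ℂ b (prodOp s W j n (prodOp s P j n a)) := by
    rw [← prodOp_inner hs hn h.small.conjTranspose_eq, inner_sub_left, inner_sub_right]
    ring
  rw [h1]
  refine (norm_add₃_le).trans (add_le_add_three ?_ ?_ ?_)
  · exact (norm_inner_le_norm _ _).trans (mul_le_mul_of_nonneg_right hb (norm_nonneg _))
  · exact (norm_inner_le_norm _ _).trans (mul_le_mul
      (norm_prodOp_le h.small.conjTranspose_eq h.small.mul_self b) ha (norm_nonneg _)
      (norm_nonneg _))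
  · refine (norm_inner_le_norm _ _).trans ?_
    have := norm_prodOp_prodOp_le hs hn h.small.conjTranspose_eq h.small.mul_self
      h.large.conjTranspose_eq h.large.mul_self h.overlap_nonneg h.mul_mul_eq a
    calc _ ≤ ‖b‖ * (c ^ n * ‖a‖) := mul_le_mul_of_nonneg_left this (norm_nonneg _)
      _ = _ := by ring

/-- The constant in the estimate of the overlap. -/
def overlapConst (T : Matrix (Fin 2) (Fin 2) ℂ) : ℝ :=
  2 * (localizationConst T + localizationConst T.adjugate + 1)

theorem overlapConst_nonneg (T : Matrix (Fin 2) (Fin 2) ℂ) : 0 ≤ overlapConst T := by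
  have := localizationConst_nonneg T
  have := localizationConst_nonneg T.adjugate
  unfold overlapConst
  positivity

/-- The k sites at either end are buffers for exclusion; the n sites between them carry the
comparison of `P` with `W`. -/
theorem norm_inner_le_of_mem_chainSpace (hs : Set.InjOn s (Set.Iic N))
    (h : IsSpectralPair T P F W F' μ ν ρ c) {k n : ℕ} (hk : 0 < k) (hpq : p + 2 * k + n = q + 1)
    (hn : 0 < n) (hq : q ≤ N) {x y : QubitSpace ι} (hx : x ∈ chainSpace T s p (q - 1))
    (hx' : ∀ w ∈ chainSpace T s p q, inner ℂ w x = 0)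
    (hy : y ∈ chainSpace T s (p + 1) q) (hy' : ∀ w ∈ chainSpace T s p q, inner ℂ w y = 0) :
    ‖inner ℂ x y‖ ≤ (overlapConst T * (ρ ^ k / (1 - ρ)) + 2 * c ^ n) * ‖x‖ * ‖y‖ := by
  have e : s p ≠ s q := hs.ne (Set.mem_Iic.2 (by omega)) hq (by omega)
  have hρ1 : 0 < 1 - ρ := by linarith [h.ratio_lt_one]
  have hL := localizationConst_nonneg T
  have hL' := localizationConst_nonneg T.adjugate
  have hP := h.large
  have hW := h.small
  set τ := ρ ^ k / (1 - ρ) with hτ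
  have hτ0 : 0 ≤ τ := div_nonneg (pow_nonneg h.ratio_nonneg k) hρ1.le
  have hτ' : ρ ^ (q - p) / (1 - ρ) ≤ τ := by
    rw [hτ]
    gcongr ?_ / _
    exact pow_le_pow_of_le_one h.ratio_nonneg h.ratio_lt_one.le (by omega)
  have hx1 := norm_siteOp_sub_prodOp_le hs h (j := p + k) (n := n) hk (by omega) (by omega) hq
    (by omega) hx hx'
  have hy1 := norm_siteOp_sub_prodOp_le_left hs h (j := p + k) (n := n) hk rfl (by omega) hq
    (by omega) hy hy'
  -- A block consisting of the opposite end site alone: this controls the mixed terms of the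
  -- splitting.
  have hx2 := norm_siteOp_sub_prodOp_le hs h (j := p) (n := 1) (k := q - p) (by omega) le_rfl
    (by omega) hq (by omega) hx hx'
  have hy2 := norm_siteOp_sub_prodOp_le_left hs h (j := q) (n := 1) (k := q - p) (by omega)
    (by omega) (by omega) hq le_rfl hy hy'
  have hx3 := norm_compl_sub_prodOp_le_left hs h (j := p + k) (n := n) hk rfl (by omega)
    (by omega) (by omega) hx
  have hy3 := norm_compl_sub_prodOp_le hs h (j := p + k) (n := n) hk (by omega) (by omega)
    le_rfl hq hy
  rw [← hτ] at hx1 hy1 hx3 hy3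
  have hx2' : ‖siteOp (s p) (1 - W) (siteOp (s q) P x)‖ ≤ localizationConst T * τ * ‖x‖ := by
    rw [map_sub, map_one, _root_.sub_apply, one_apply_eq_self]
    exact hx2.trans (by gcongr)
  have hy2' : ‖siteOp (s q) (1 - P) (siteOp (s p) W y)‖ ≤
      localizationConst T.adjugate * τ * ‖y‖ := by
    rw [map_sub, map_one, _root_.sub_apply, one_apply_eq_self]
    exact hy2.trans (by gcongr)
  have n1 := norm_siteOp_le_of_proj hP.conjTranspose_eq hP.mul_self (s q) x
  have n2 := norm_siteOp_le_of_proj hP.compl_conjTranspose hP.compl_mul_self (s q) y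
  have n3 := norm_siteOp_le_of_proj hW.conjTranspose_eq hW.mul_self (s p) y
  have n4 := norm_siteOp_le_of_proj hW.compl_conjTranspose hW.compl_mul_self (s p) x
  have hcn : 0 ≤ c ^ n := pow_nonneg h.overlap_nonneg n
  -- Both ends are split by `P` at q and `W` at p. In the first and last terms one factor is close
  -- to `P` and the other close to `W` on the block; the two mixed terms are small by themselves.
  have hsplit : inner ℂ x y = inner ℂ (siteOp (s q) P x) (siteOp (s p) W y) +
      inner ℂ (siteOp (s p) (1 - W) (siteOp (s q) P x)) y +
      inner ℂ x (siteOp (s q) (1 - P) (siteOp (s p) W y)) +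
      inner ℂ (siteOp (s p) (1 - W) x) (siteOp (s q) (1 - P) y) := by
    rw [siteOp_inner (s p) (1 - W) (siteOp (s q) P x), hW.compl_conjTranspose,
      siteOp_inner (s p) (1 - W) x, hW.compl_conjTranspose, siteOp_commute e (1 - W),
      ← hP.compl_conjTranspose, ← siteOp_inner, ← siteOp_inner,
      ← inner_add_right, add_assoc, ← inner_add_right, ← siteOp_add_compl W, ← inner_add_left,
      ← siteOp_add_compl P]
  have t1 := norm_inner_le_of_prodOp hs h (by omega) hy1 hx1
  have t4 := norm_inner_le_of_prodOp hs h (by omega) hx3 hy3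
  rw [← inner_conj_symm, RCLike.norm_conj] at t4
  have t2 := (norm_inner_le_norm (𝕜 := ℂ) (siteOp (s p) (1 - W) (siteOp (s q) P x)) y).trans
    (mul_le_mul_of_nonneg_right hx2' (norm_nonneg _))
  have t3 := (norm_inner_le_norm (𝕜 := ℂ) x (siteOp (s q) (1 - P) (siteOp (s p) W y))).trans
    (mul_le_mul_of_nonneg_left hy2' (norm_nonneg _))
  rw [hsplit]
  refine (norm_add₄_le).trans ((add_le_add (add_le_add_three t1 t2 t3) t4).trans ?_)
  have b1 : localizationConst T * τ * ‖x‖ * ‖siteOp (s p) W y‖ +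
      ‖siteOp (s q) P x‖ * (localizationConst T.adjugate * τ * ‖y‖) +
      c ^ n * ‖siteOp (s q) P x‖ * ‖siteOp (s p) W y‖ ≤
      localizationConst T * τ * ‖x‖ * ‖y‖ +
      ‖x‖ * (localizationConst T.adjugate * τ * ‖y‖) + c ^ n * ‖x‖ * ‖y‖ := by
    gcongr
  have b2 : τ * ‖y‖ * ‖siteOp (s p) (1 - W) x‖ + ‖siteOp (s q) (1 - P) y‖ * (τ * ‖x‖) +
      c ^ n * ‖siteOp (s q) (1 - P) y‖ * ‖siteOp (s p) (1 - W) x‖ ≤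
      τ * ‖y‖ * ‖x‖ + ‖y‖ * (τ * ‖x‖) + c ^ n * ‖y‖ * ‖x‖ := by
    gcongr
  refine (add_le_add (add_le_add (add_le_add b1 le_rfl) le_rfl) b2).trans (le_of_eq ?_)
  unfold overlapConst
  ring

end Overlap

/-! ### From one-site extensions to arbitrary blocks -/

section Telescoping

variable {ι : Type} [Fintype ι] [DecidableEq ι] {T P F W F' : Matrix (Fin 2) (Fin 2) ℂ} {s : ℕ → ι}
  {N p q : ℕ} {μ ν : ℂ} {ρ c : ℝ}

theorem chainProj_mul_chainProj {p' q' : ℕ} (hp : p' ≤ p) (hq : q ≤ q') :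
    (chainProj T s p' q' * chainProj T s p q : QubitSpace ι →L[ℂ] QubitSpace ι) =
      chainProj T s p' q' :=
  ContinuousLinearMap.ext fun x => chainProj_chainProj hp hq x

theorem chainProj_mul_chainProj' {p' q' : ℕ} (hp : p' ≤ p) (hq : q ≤ q') :
    (chainProj T s p q * chainProj T s p' q' : QubitSpace ι →L[ℂ] QubitSpace ι) =
      chainProj T s p' q' :=
  ContinuousLinearMap.ext fun x =>
    Submodule.starProjection_eq_self_iff.2 (chainSpace_mono hp hq (chainProj_mem x))

theorem norm_chainProj_le :
    ‖(chainProj T s p q : QubitSpace ι →L[ℂ] QubitSpace ι)‖ ≤ 1 :=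
  Submodule.starProjection_norm_le _

/-- A one-site extension on both sides changes the projector by an error decaying exponentially in
the number of common sites. -/
theorem norm_chainProj_sub_mul_le_succ (hs : Set.InjOn s (Set.Iic N))
    (h : IsSpectralPair T P F W F' μ ν ρ c) (hpq : p < q) (hq : q + 1 ≤ N) :
    ‖(chainProj T s p (q + 1) - chainProj T s p q * chainProj T s (p + 1) (q + 1) :
      QubitSpace ι →L[ℂ] QubitSpace ι)‖ ≤
      overlapConst T / (1 - ρ) * √(√ρ) ^ (q - p) + 2 * √c ^ (q - p) := by
  obtain ⟨m, rfl⟩ : ∃ m, q = p + m := ⟨q - p, by omega⟩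
  have hρ1 : 0 < 1 - ρ := by linarith [h.ratio_lt_one]
  have hC := overlapConst_nonneg T
  have hc := pow_nonneg h.overlap_nonneg (m + 2 - 2 * (m / 4 + 1))
  have hρk := pow_nonneg h.ratio_nonneg (m / 4 + 1)
  rw [show p + m - p = m by omega]
  have hX : chainSpace T s p (p + m + 1) ≤ chainSpace T s p (p + m) :=
    chainSpace_mono le_rfl (Nat.le_succ _)
  have hY : chainSpace T s p (p + m + 1) ≤ chainSpace T s (p + 1) (p + m + 1) :=
    chainSpace_mono (Nat.le_succ _) le_rfl
  unfold chainProj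
  -- The buffer length `m / 4 + 1` is positive and at least m/4, while at least m/2 sites remain
  -- between the buffers.
  refine (norm_starProjection_sub_mul_le hX hY
    (ε := overlapConst T * (ρ ^ (m / 4 + 1) / (1 - ρ)) + 2 * c ^ (m + 2 - 2 * (m / 4 + 1)))
    (by positivity) fun x hx hx' y hy hy' => ?_).trans ?_
  · exact norm_inner_le_of_mem_chainSpace hs h (Nat.succ_pos _) (by omega) (by omega) hq hx hx'
      hy hy'
  · have h1 : ρ ^ (m / 4 + 1) ≤ √(√ρ) ^ m := by
      have h2 : ρ = √(√ρ) ^ 4 := by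
        rw [show (4 : ℕ) = 2 * 2 from rfl, pow_mul, Real.sq_sqrt (Real.sqrt_nonneg _),
          Real.sq_sqrt h.ratio_nonneg]
      conv_lhs => rw [h2, ← pow_mul]
      refine pow_le_pow_of_le_one (Real.sqrt_nonneg _) ?_ (by omega)
      rw [Real.sqrt_le_one, Real.sqrt_le_one]
      exact h.ratio_lt_one.le
    have h3 : c ^ (m + 2 - 2 * (m / 4 + 1)) ≤ √c ^ m := by
      conv_lhs => rw [← Real.sq_sqrt h.overlap_nonneg, ← pow_mul]
      refine pow_le_pow_of_le_one (Real.sqrt_nonneg _) ?_ (by omega)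
      rw [Real.sqrt_le_one]
      exact h.overlap_lt_one.le
    rw [← mul_div_assoc, mul_div_right_comm]
    gcongr

theorem sum_range_pow_add_le {θ : ℝ} (h0 : 0 ≤ θ) (h1 : θ < 1) (k n : ℕ) :
    ∑ i ∈ Finset.range n, θ ^ (k + i) ≤ θ ^ k / (1 - θ) := by
  simp only [pow_add, ← Finset.mul_sum]
  rw [div_eq_mul_inv, ← tsum_geometric_of_lt_one h0 h1]
  exact mul_le_mul_of_nonneg_left ((summable_geometric_of_lt_one h0 h1).sum_le_tsum _
    fun _ _ => pow_nonneg h0 _) (pow_nonneg h0 k)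

/-- Adding a site on the right costs one one-site defect, with an overlap longer by one each time;
the earlier defect is only multiplied by a contraction. -/
theorem norm_chainProj_sub_mul_le_sum_right {ε : ℕ → ℝ}
    (hε : ∀ p q, p < q → q + 1 ≤ N →
      ‖(chainProj T s p (q + 1) - chainProj T s p q * chainProj T s (p + 1) (q + 1) :
        QubitSpace ι →L[ℂ] QubitSpace ι)‖ ≤ ε (q - p))
    {b : ℕ} (hpq : p < q) (hq : q + b ≤ N) :
    ‖(chainProj T s p (q + b) - chainProj T s p q * chainProj T s (p + 1) (q + b) :
      QubitSpace ι →L[ℂ] QubitSpace ι)‖ ≤ ∑ i ∈ Finset.range b, ε (q - p + i) := by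
  induction b with
  | zero => simp [chainProj_mul_chainProj (T := T) (s := s) (Nat.le_succ p) (le_refl q)]
  | succ b ih =>
    have h1 := hε p (q + b) (by omega) (by omega)
    have h2 : (chainProj T s p (q + (b + 1)) -
        chainProj T s p q * chainProj T s (p + 1) (q + (b + 1)) :
        QubitSpace ι →L[ℂ] QubitSpace ι) =
        (chainProj T s p (q + b + 1) - chainProj T s p (q + b) *
          chainProj T s (p + 1) (q + b + 1)) +
        (chainProj T s p (q + b) - chainProj T s p q * chainProj T s (p + 1) (q + b)) *
          chainProj T s (p + 1) (q + b + 1) := by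
      rw [sub_mul, mul_assoc (chainProj T s p q),
        chainProj_mul_chainProj' (T := T) (s := s) (le_refl (p + 1)) (Nat.le_succ (q + b)),
        ← add_assoc]
      abel
    rw [h2, Finset.sum_range_succ, add_comm]
    refine (norm_add_le _ _).trans (add_le_add ?_ ?_)
    · refine (norm_mul_le _ _).trans ((mul_le_of_le_one_right (norm_nonneg _)
        norm_chainProj_le).trans (ih (by omega)))
    · rwa [show q - p + b = q + b - p by omega]

/-- The same telescoping at the left end, where increasing `a` by one with q fixed shortens the
overlap by one. -/
theorem norm_chainProj_sub_mul_le_sum_left {δ : ℕ → ℝ} {b r : ℕ}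
    (hδ : ∀ p, p < q →
      ‖(chainProj T s p (q + b) - chainProj T s p q * chainProj T s (p + 1) (q + b) :
        QubitSpace ι →L[ℂ] QubitSpace ι)‖ ≤ δ (q - p))
    {a : ℕ} (hq : p + a + r = q + 1) (hr : 0 < r) :
    ‖(chainProj T s p (q + b) - chainProj T s p q * chainProj T s (p + a) (q + b) :
      QubitSpace ι →L[ℂ] QubitSpace ι)‖ ≤ ∑ i ∈ Finset.range a, δ (r + i) := by
  induction a generalizing r with
  | zero => simp [chainProj_mul_chainProj' (T := T) (s := s) (le_refl p) (Nat.le_add_right q b)]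
  | succ a ih =>
    have h1 := hδ (p + a) (by omega)
    have h2 : (chainProj T s p (q + b) -
        chainProj T s p q * chainProj T s (p + (a + 1)) (q + b) :
        QubitSpace ι →L[ℂ] QubitSpace ι) =
        (chainProj T s p (q + b) - chainProj T s p q * chainProj T s (p + a) (q + b)) +
        chainProj T s p q * (chainProj T s (p + a) (q + b) -
          chainProj T s (p + a) q * chainProj T s (p + a + 1) (q + b)) := by
      rw [mul_sub, ← mul_assoc,
        chainProj_mul_chainProj (T := T) (s := s) (Nat.le_add_right p a) (le_refl q),
        ← add_assoc]
      abel
    rw [h2, Finset.sum_range_succ']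
    refine (norm_add_le _ _).trans (add_le_add ?_ ?_)
    · have := ih (r := r + 1) (by omega) (by omega)
      simpa only [add_assoc, add_comm 1] using this
    · refine (norm_mul_le _ _).trans ((mul_le_of_le_one_left (norm_nonneg _)
        norm_chainProj_le).trans ?_)
      rwa [show q - (p + a) = r + 0 by omega] at h1

theorem sum_range_two_pow_le {A B θ φ : ℝ} (hA : 0 ≤ A) (hB : 0 ≤ B) (hθ : 0 ≤ θ) (hθ1 : θ < 1)
    (hφ : 0 ≤ φ) (hφ1 : φ < 1) (k n : ℕ) :
    ∑ i ∈ Finset.range n, (A * θ ^ (k + i) + B * φ ^ (k + i)) ≤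
      A / (1 - θ) * θ ^ k + B / (1 - φ) * φ ^ k := by
  rw [Finset.sum_add_distrib, ← Finset.mul_sum, ← Finset.mul_sum, div_mul_eq_mul_div,
    mul_div_assoc, div_mul_eq_mul_div, mul_div_assoc]
  exact add_le_add (mul_le_mul_of_nonneg_left (sum_range_pow_add_le hθ hθ1 k n) hA)
    (mul_le_mul_of_nonneg_left (sum_range_pow_add_le hφ hφ1 k n) hB)

/-- Exponential decay of the defect in the number `r` of common sites of two intervals. -/
theorem norm_chainProj_sub_mul_le (hs : Set.InjOn s (Set.Iic N))
    (h : IsSpectralPair T P F W F' μ ν ρ c) {a r b : ℕ} (hq : p + a + r = q + 1) (hr : 0 < r)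
    (hN : q + b ≤ N) :
    ‖(chainProj T s p (q + b) - chainProj T s p q * chainProj T s (p + a) (q + b) :
      QubitSpace ι →L[ℂ] QubitSpace ι)‖ ≤
      overlapConst T / (1 - ρ) / (1 - √(√ρ)) / (1 - √(√ρ)) * √(√ρ) ^ r +
        2 / (1 - √c) / (1 - √c) * √c ^ r := by
  have hρ1 : 0 < 1 - ρ := by linarith [h.ratio_lt_one]
  have hθ : √(√ρ) < 1 := by
    rw [Real.sqrt_lt' one_pos, one_pow, Real.sqrt_lt' one_pos, one_pow]
    exact h.ratio_lt_one
  have hφ : √c < 1 := by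
    rw [Real.sqrt_lt' one_pos, one_pow]
    exact h.overlap_lt_one
  have hθ' : 0 < 1 - √(√ρ) := by linarith
  have hφ' : 0 < 1 - √c := by linarith
  have hC := overlapConst_nonneg T
  refine (norm_chainProj_sub_mul_le_sum_left (δ := fun m =>
    overlapConst T / (1 - ρ) / (1 - √(√ρ)) * √(√ρ) ^ m + 2 / (1 - √c) * √c ^ m)
    (fun p hp => ?_) hq hr).trans ?_
  · refine (norm_chainProj_sub_mul_le_sum_right (N := N)
      (ε := fun m => overlapConst T / (1 - ρ) * √(√ρ) ^ m + 2 * √c ^ m)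
      (fun p q hpq hq => norm_chainProj_sub_mul_le_succ hs h hpq hq) hp hN).trans ?_
    exact sum_range_two_pow_le (by positivity) (by positivity) (Real.sqrt_nonneg _) hθ
      (Real.sqrt_nonneg _) hφ _ _
  · exact sum_range_two_pow_le (by positivity) (by positivity) (Real.sqrt_nonneg _) hθ
      (Real.sqrt_nonneg _) hφ _ _

end Telescoping

/-! ### Eigenprojections of a 2 × 2 matrix and uniqueness of its spectral data -/

section Eigenvectors

/-- The partial isometry sends (x, y) to the orthogonal unit vector (−ȳ, x̄). Each identity is a
combination of the eigenvector equations, trace, determinant and normalization. -/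
theorem isEigenprojection_of_eigenvector {T : Matrix (Fin 2) (Fin 2) ℂ} {μ ν x y : ℂ}
    (h0 : T 0 0 * x + T 0 1 * y = ν * x) (h1 : T 1 0 * x + T 1 1 * y = ν * y)
    (htr : T 0 0 + T 1 1 = μ + ν) (hdet : T.det = μ * ν) (hn : x * star x + y * star y = 1) :
    IsEigenprojection T !![x * star x, x * star y; y * star x, y * star y]
      !![-star y * star x, -star y * star y; star x * star x, star x * star y] μ ν := by
  have hn' : star x * x + star y * y = 1 := by linear_combination hn
  have hP : (1 : Matrix (Fin 2) (Fin 2) ℂ) - !![x * star x, x * star y; y * star x, y * star y] =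
      !![star y * y, -(star y * x); -(star x * y), star x * x] := by
    ext i j
    fin_cases i <;> fin_cases j <;> simp only [Fin.zero_eta, Fin.mk_one, Fin.isValue,
      Matrix.sub_apply, Matrix.one_apply, Matrix.of_apply, Matrix.cons_val', Matrix.cons_val_zero,
      Matrix.cons_val_one, Matrix.cons_val_fin_one, if_true, one_ne_zero, zero_ne_one, if_false]
    · linear_combination -hn
    · ring
    · ring
    · linear_combination -hn
  generalize hX : star x = X at *
  generalize hY : star y = Y at *
  have hX' : star X = x := by rw [← hX, star_star]
  have hY' : star Y = y := by rw [← hY, star_star]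
  refine ⟨?_, ?_, ?_, ?_, ?_, ?_, hdet, ?_, ?_, ?_, ?_⟩
  · ext i j
    fin_cases i <;> fin_cases j <;>
      simp [Matrix.conjTranspose_apply, ← starRingEnd_apply] <;>
      simp only [starRingEnd_apply, hX, hY, hX', hY'] <;> ring
  · ext i j
    fin_cases i <;> fin_cases j <;> simp [Matrix.mul_apply, Fin.sum_univ_two]
    · linear_combination (x * X) * hn
    · linear_combination (x * Y) * hn
    · linear_combination (y * X) * hn
    · linear_combination (y * Y) * hn
  · rw [hP]
    ext i j
    fin_cases i <;> fin_cases j <;> simp [Matrix.mul_apply, Fin.sum_univ_two]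
    · linear_combination (-Y) * h1 + Y * y * htr
    · linear_combination Y * h0 - Y * x * htr
    · linear_combination X * h1 - X * y * htr
    · linear_combination (-X) * h0 + X * x * htr
  · rw [hP, Matrix.adjugate_fin_two]
    ext i j
    fin_cases i <;> fin_cases j <;> simp [Matrix.mul_apply, Fin.sum_univ_two]
    · linear_combination Y * h1
    · linear_combination (-Y) * h0
    · linear_combination (-X) * h1
    · linear_combination X * h0
  · ext i j
    fin_cases i <;> fin_cases j <;> simp [Matrix.mul_apply, Fin.sum_univ_two]
    · linear_combination X * h0
    · linear_combination Y * h0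
    · linear_combination X * h1
    · linear_combination Y * h1
  · rw [Matrix.adjugate_fin_two]
    ext i j
    fin_cases i <;> fin_cases j <;> simp [Matrix.mul_apply, Fin.sum_univ_two]
    · linear_combination (-X) * h0 + X * x * htr
    · linear_combination (-Y) * h0 + Y * x * htr
    · linear_combination (-X) * h1 + X * y * htr
    · linear_combination (-Y) * h1 + Y * y * htr
  · rw [Matrix.det_fin_two]
    simp
    ring
  · rw [hP, Matrix.det_fin_two]
    simp
    ring
  · ext i j
    fin_cases i <;> fin_cases j <;>
      simp [Matrix.mul_apply, Fin.sum_univ_two, Matrix.conjTranspose_apply,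
        ← starRingEnd_apply] <;>
      simp only [starRingEnd_apply, hX', hY']
    · linear_combination (x * X) * hn
    · linear_combination (x * Y) * hn
    · linear_combination (y * X) * hn
    · linear_combination (y * Y) * hn
  · rw [hP]
    ext i j
    fin_cases i <;> fin_cases j <;> simp [Matrix.mul_apply, Fin.sum_univ_two]
    · linear_combination (-Y * X) * hn
    · linear_combination (-Y * Y) * hn
    · linear_combination (X * X) * hn
    · linear_combination (X * Y) * hn

/-- The projector onto the line spanned by a unit vector. -/
def lineProj (v : EuclideanSpace ℂ (Fin 2)) : Matrix (Fin 2) (Fin 2) ℂ :=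
  !![v 0 * star (v 0), v 0 * star (v 1); v 1 * star (v 0), v 1 * star (v 1)]

/-- The partial isometry mapping a unit vector to an orthogonal unit vector. -/
def lineFlip (v : EuclideanSpace ℂ (Fin 2)) : Matrix (Fin 2) (Fin 2) ℂ :=
  !![-star (v 1) * star (v 0), -star (v 1) * star (v 1);
    star (v 0) * star (v 0), star (v 0) * star (v 1)]

theorem inner_eq_two (u v : EuclideanSpace ℂ (Fin 2)) :
    inner ℂ u v = v 0 * star (u 0) + v 1 * star (u 1) := by
  rw [PiLp.inner_apply, Fin.sum_univ_two]
  rfl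

theorem sum_mul_star_eq_one {v : EuclideanSpace ℂ (Fin 2)} (hv : ‖v‖ = 1) :
    v 0 * star (v 0) + v 1 * star (v 1) = 1 := by
  have h := inner_self_eq_norm_sq_to_K (𝕜 := ℂ) v
  rw [hv, inner_eq_two] at h
  rw [h]
  simp

theorem coords_of_hasEigenvector {T : Matrix (Fin 2) (Fin 2) ℂ} {μ : ℂ} {u : EuclideanSpace ℂ (Fin 2)}
    (h : Module.End.HasEigenvector (Matrix.toEuclideanLin T) μ u) :
    T 0 0 * u 0 + T 0 1 * u 1 = μ * u 0 ∧ T 1 0 * u 0 + T 1 1 * u 1 = μ * u 1 := by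
  have h1 := h.apply_eq_smul
  constructor
  · have := congrArg (fun w : EuclideanSpace ℂ (Fin 2) => w 0) h1
    simpa [Matrix.mulVec, dotProduct, Fin.sum_univ_two] using this
  · have := congrArg (fun w : EuclideanSpace ℂ (Fin 2) => w 1) h1
    simpa [Matrix.mulVec, dotProduct, Fin.sum_univ_two] using this

theorem exists_smul_eq {u v : EuclideanSpace ℂ (Fin 2)} (hu : ‖u‖ = 1) (hv : ‖v‖ = 1)
    (h : u 0 * v 1 = u 1 * v 0) : ∃ k : ℂ, ‖k‖ = 1 ∧ u = k • v := by
  have hk : u = (star (v 0) * u 0 + star (v 1) * u 1) • v := by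
    have hn := sum_mul_star_eq_one hv
    ext i
    fin_cases i
    · simp only [Fin.zero_eta, PiLp.smul_apply, smul_eq_mul]
      linear_combination (-u 0) * hn + star (v 1) * h
    · simp only [Fin.mk_one, PiLp.smul_apply, smul_eq_mul]
      linear_combination (-u 1) * hn - star (v 0) * h
  refine ⟨_, ?_, hk⟩
  have := congrArg norm hk
  rwa [norm_smul, hu, hv, mul_one, eq_comm] at this

variable {T : Matrix (Fin 2) (Fin 2) ℂ} {μ ν : ℂ} {u v : EuclideanSpace ℂ (Fin 2)}

theorem cross_ne_zero (hu : Module.End.HasEigenvector (Matrix.toEuclideanLin T) μ u)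
    (hv : Module.End.HasEigenvector (Matrix.toEuclideanLin T) ν v) (hμν : μ ≠ ν)
    (hu1 : ‖u‖ = 1) (hv1 : ‖v‖ = 1) : u 0 * v 1 - u 1 * v 0 ≠ 0 := by
  intro h
  obtain ⟨k, hk, rfl⟩ := exists_smul_eq hu1 hv1 (sub_eq_zero.1 h)
  have h1 := hu.apply_eq_smul
  rw [map_smul, hv.apply_eq_smul, smul_comm k ν v] at h1
  exact hμν ((smul_left_injective ℂ hu.2) h1).symm

theorem trace_eq_of_hasEigenvector
    (hu : Module.End.HasEigenvector (Matrix.toEuclideanLin T) μ u)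
    (hv : Module.End.HasEigenvector (Matrix.toEuclideanLin T) ν v)
    (h : u 0 * v 1 - u 1 * v 0 ≠ 0) : T 0 0 + T 1 1 = μ + ν ∧ T.det = μ * ν := by
  obtain ⟨u0, u1⟩ := coords_of_hasEigenvector hu
  obtain ⟨v0, v1⟩ := coords_of_hasEigenvector hv
  constructor
  · refine mul_right_cancel₀ h ?_
    linear_combination v 1 * u0 - v 0 * u1 + u 0 * v1 - u 1 * v0
  · refine mul_right_cancel₀ h ?_
    rw [Matrix.det_fin_two]
    linear_combination (T 1 0 * v 0 + T 1 1 * v 1) * u0 - (T 0 0 * v 0 + T 0 1 * v 1) * u1 +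
      μ * u 0 * v1 - μ * u 1 * v0

theorem norm_inner_sq (u v : EuclideanSpace ℂ (Fin 2)) :
    ((‖inner ℂ u v‖ ^ 2 : ℝ) : ℂ) = (v 0 * star (u 0) + v 1 * star (u 1)) *
      (star (v 0) * u 0 + star (v 1) * u 1) := by
  rw [← Complex.normSq_eq_norm_sq, ← Complex.mul_conj, inner_eq_two]
  simp

theorem lineProj_mul_mul (u v : EuclideanSpace ℂ (Fin 2)) :
    lineProj v * lineProj u * lineProj v = ((‖inner ℂ u v‖ ^ 2 : ℝ) : ℂ) • lineProj v := by
  rw [norm_inner_sq]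
  ext i j
  fin_cases i <;> fin_cases j <;> simp [lineProj, Matrix.mul_apply, Fin.sum_univ_two] <;> ring

/-- Lagrange's identity: the squared overlap and the squared cross product of two unit vectors add
up to one. -/
theorem norm_inner_lt_one (hu1 : ‖u‖ = 1) (hv1 : ‖v‖ = 1) (h : u 0 * v 1 - u 1 * v 0 ≠ 0) :
    ‖inner ℂ u v‖ < 1 := by
  have h1 : ‖inner ℂ u v‖ ^ 2 + ‖u 0 * v 1 - u 1 * v 0‖ ^ 2 = 1 := by
    have h2 := sum_mul_star_eq_one hu1
    have h3 := sum_mul_star_eq_one hv1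
    have h4 := norm_inner_sq u v
    have h5 : ((‖u 0 * v 1 - u 1 * v 0‖ ^ 2 : ℝ) : ℂ) = (u 0 * v 1 - u 1 * v 0) *
        (star (u 0) * star (v 1) - star (u 1) * star (v 0)) := by
      rw [← Complex.normSq_eq_norm_sq, ← Complex.mul_conj]
      simp
    refine Complex.ofReal_injective ?_
    rw [Complex.ofReal_add, h4, h5, Complex.ofReal_one]
    linear_combination (v 0 * star (v 0) + v 1 * star (v 1)) * h2 + h3
  have h2 : 0 < ‖u 0 * v 1 - u 1 * v 0‖ := norm_pos_iff.2 h
  nlinarith [norm_nonneg (inner ℂ u v)]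

theorem isSpectralPair_of_hasEigenvector
    (hu : Module.End.HasEigenvector (Matrix.toEuclideanLin T) μ u)
    (hv : Module.End.HasEigenvector (Matrix.toEuclideanLin T) ν v) (hμν : ‖μ‖ < ‖ν‖)
    (hu1 : ‖u‖ = 1) (hv1 : ‖v‖ = 1) :
    IsSpectralPair T (lineProj v) (lineFlip v) (lineProj u) (lineFlip u) μ ν (‖μ‖ / ‖ν‖)
      ‖inner ℂ u v‖ := by
  have hν : 0 < ‖ν‖ := (norm_nonneg μ).trans_lt hμν
  have hD := cross_ne_zero hu hv (by rintro rfl; exact lt_irrefl _ hμν) hu1 hv1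
  obtain ⟨htr, hdet⟩ := trace_eq_of_hasEigenvector hu hv hD
  obtain ⟨u0, u1⟩ := coords_of_hasEigenvector hu
  obtain ⟨v0, v1⟩ := coords_of_hasEigenvector hv
  refine ⟨isEigenprojection_of_eigenvector v0 v1 htr hdet (sum_mul_star_eq_one hv1),
    isEigenprojection_of_eigenvector u0 u1 (by rw [htr, add_comm]) (by rw [hdet, mul_comm])
    (sum_mul_star_eq_one hu1), norm_pos_iff.1 hν, (div_mul_cancel₀ _ hν.ne').symm, by positivity,
    (div_lt_one hν).2 hμν, norm_nonneg _, norm_inner_lt_one hu1 hv1 hD, lineProj_mul_mul u v, ?_⟩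
  rw [← norm_inner_symm]
  exact lineProj_mul_mul v u

/-- The eigenvalues of different modulus and the overlap of the unit eigenvectors are determined
by the matrix. -/
theorem eq_of_hasEigenvector {μ' ν' : ℂ} {u' v' : EuclideanSpace ℂ (Fin 2)}
    (hu : Module.End.HasEigenvector (Matrix.toEuclideanLin T) μ u)
    (hv : Module.End.HasEigenvector (Matrix.toEuclideanLin T) ν v) (hμν : ‖μ‖ < ‖ν‖)
    (hu1 : ‖u‖ = 1) (hv1 : ‖v‖ = 1)
    (hu' : Module.End.HasEigenvector (Matrix.toEuclideanLin T) μ' u')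
    (hv' : Module.End.HasEigenvector (Matrix.toEuclideanLin T) ν' v') (hμν' : ‖μ'‖ < ‖ν'‖)
    (hu1' : ‖u'‖ = 1) (hv1' : ‖v'‖ = 1) :
    μ' = μ ∧ ν' = ν ∧ ‖inner ℂ u' v'‖ = ‖inner ℂ u v‖ := by
  have hne : μ ≠ ν := by rintro rfl; exact lt_irrefl _ hμν
  have hne' : μ' ≠ ν' := by rintro rfl; exact lt_irrefl _ hμν'
  obtain ⟨htr, hdet⟩ := trace_eq_of_hasEigenvector hu hv (cross_ne_zero hu hv hne hu1 hv1)
  obtain ⟨htr', hdet'⟩ :=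
    trace_eq_of_hasEigenvector hu' hv' (cross_ne_zero hu' hv' hne' hu1' hv1')
  -- Both pairs have the same sum and product; the ordering by modulus then excludes the
  -- interchanged assignment.
  have h1 : (μ' - μ) * (μ' - ν) = 0 := by
    linear_combination μ' * htr - μ' * htr' - hdet + hdet'
  have hμ : μ' = μ := by
    rcases mul_eq_zero.1 h1 with h | h
    · exact sub_eq_zero.1 h
    · exfalso
      obtain rfl := sub_eq_zero.1 h
      obtain rfl : ν' = μ := by linear_combination htr - htr'
      exact lt_asymm hμν hμν'
  subst hμ
  obtain rfl : ν' = ν := by linear_combination htr - htr'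
  refine ⟨rfl, rfl, ?_⟩
  have key : ∀ {κ : ℂ} {w w' : EuclideanSpace ℂ (Fin 2)},
      Module.End.HasEigenvector (Matrix.toEuclideanLin T) κ w →
      Module.End.HasEigenvector (Matrix.toEuclideanLin T) κ w' → ‖w‖ = 1 → ‖w'‖ = 1 →
      ∃ k : ℂ, ‖k‖ = 1 ∧ w' = k • w := by
    intro κ w w' h h' hw hw'
    refine exists_smul_eq hw' hw ?_
    -- Two independent eigenvectors for κ would make the discriminant vanish.
    by_contra hcon
    obtain ⟨ht, hd⟩ := trace_eq_of_hasEigenvector h' h (sub_ne_zero.2 hcon)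
    have h2 : (μ' - ν') ^ 2 = 0 := by
      have e1 := htr.symm.trans ht
      have e2 := hdet.symm.trans hd
      linear_combination (μ' + ν' + κ + κ) * e1 - 4 * e2
    exact hne (sub_eq_zero.1 (pow_eq_zero_iff two_ne_zero |>.1 h2))
  obtain ⟨k, hk, rfl⟩ := key hu hu' hu1 hu1'
  obtain ⟨l, hl, rfl⟩ := key hv hv' hv1 hv1'
  rw [inner_smul_left, inner_smul_right, norm_mul, norm_mul, RCLike.norm_conj, hk, hl, one_mul,
    one_mul]

end Eigenvectors

/-! ### Identifying ground spaces with chain spaces -/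

section GroundSpace

variable {n : ℕ} {ψ : TwoQubit}

/-- The contraction of the qubits `i` and `j` of `ξ` with `ψ`. -/
def contraction (ψ : TwoQubit) (i j : Fin n) (ξ : Chain n) (x : Fin n → Fin 2) : ℂ :=
  ∑ a, ∑ b, star (ψ (a, b)) * ξ (Function.update (Function.update x i a) j b)

theorem contraction_congr {i j : Fin n} {x y : Fin n → Fin 2} (h : ∀ k, k ≠ i → k ≠ j → x k = y k)
    (ξ : Chain n) : contraction ψ i j ξ x = contraction ψ i j ξ y := by
  have : ∀ a b, Function.update (Function.update x i a) j b =
      Function.update (Function.update y i a) j b := by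
    intro a b
    ext k
    by_cases hj : k = j
    · subst hj; simp
    by_cases hi : k = i
    · subst hi; simp [hj]
    simp [hi, hj, h k hi hj]
  simp only [contraction, this]

theorem pairProjector_apply {i j : Fin n} (h : i ≠ j) (ξ : Chain n) (x : Fin n → Fin 2) :
    Matrix.toEuclideanLin (pairProjector ψ i j) ξ x = ψ (x i, x j) * contraction ψ i j ξ x := by
  have h1 : Matrix.toEuclideanLin (pairProjector ψ i j) ξ x =
      ∑ y, (if ∀ k, k ≠ i → k ≠ j → x k = y k then ψ (x i, x j) * star (ψ (y i, y j)) else 0) *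
        ξ y := rfl
  rw [h1]
  simp only [ite_mul, zero_mul]
  rw [← Finset.sum_filter, contraction, Finset.mul_sum]
  simp only [Finset.mul_sum]
  rw [← Finset.sum_product']
  refine Finset.sum_bij' (fun y _ => (y i, y j))
    (fun p _ => Function.update (Function.update x i p.1) j p.2) (by simp) ?_ ?_ ?_ ?_
  · rintro ⟨a, b⟩ _
    rw [Finset.mem_filter]
    refine ⟨Finset.mem_univ _, fun k hi hj => ?_⟩
    simp [hi, hj]
  · intro y hy
    have hy := (Finset.mem_filter.1 hy).2
    ext k
    by_cases hj : k = j
    · subst hj; simp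
    by_cases hi : k = i
    · subst hi; simp [hj]
    simp [hi, hj, hy k hi hj]
  · rintro ⟨a, b⟩ _
    simp [h]
  · intro y hy
    have hy := (Finset.mem_filter.1 hy).2
    have : Function.update (Function.update x i (y i)) j (y j) = y := by
      ext k
      by_cases hj : k = j
      · subst hj; simp
      by_cases hi : k = i
      · subst hi; simp [hj]
      simp [hi, hj, hy k hi hj]
    simp only [this]
    ring

theorem sum_star_mul_self (hψ : ‖ψ‖ = 1) : ∑ a, ∑ b, star (ψ (a, b)) * ψ (a, b) = 1 := by
  have h := inner_self_eq_norm_sq_to_K (𝕜 := ℂ) ψ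
  rw [hψ, PiLp.inner_apply, Fintype.sum_prod_type] at h
  simp only [RCLike.inner_apply] at h
  simp only [mul_comm (star _)]
  exact h.trans (by norm_num)

theorem inner_pairProjector (hψ : ‖ψ‖ = 1) {i j : Fin n} (h : i ≠ j) (ξ : Chain n) :
    inner ℂ ξ (Matrix.toEuclideanLin (pairProjector ψ i j) ξ) =
      (‖Matrix.toEuclideanLin (pairProjector ψ i j) ξ‖ : ℂ) ^ 2 := by
  have hherm : (pairProjector ψ i j)ᴴ = pairProjector ψ i j := by
    ext x y
    simp only [pairProjector, Matrix.conjTranspose_apply, Matrix.of_apply]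
    rw [apply_ite star, star_zero, star_mul', star_star, mul_comm]
    simp only [eq_comm]
  have hidem : Matrix.toEuclideanLin (pairProjector ψ i j)
      (Matrix.toEuclideanLin (pairProjector ψ i j) ξ) =
      Matrix.toEuclideanLin (pairProjector ψ i j) ξ := by
    ext x
    rw [pairProjector_apply h, pairProjector_apply h]
    congr 1
    have h1 : ∀ a b, contraction ψ i j ξ (Function.update (Function.update x i a) j b) =
        contraction ψ i j ξ x := fun a b =>
      contraction_congr (fun k hi hj => by simp [hi, hj]) ξ
    have h2 : contraction ψ i j (Matrix.toEuclideanLin (pairProjector ψ i j) ξ) x =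
        ∑ a, ∑ b, star (ψ (a, b)) * (ψ (a, b) * contraction ψ i j ξ x) := by
      simp only [contraction]
      refine Finset.sum_congr rfl fun a _ => Finset.sum_congr rfl fun b _ => ?_
      rw [pairProjector_apply h, h1]
      simp [h, contraction]
    rw [h2]
    simp only [← mul_assoc, ← Finset.sum_mul]
    rw [sum_star_mul_self hψ, one_mul]
  have hadj : ∀ ξ η : Chain n, inner ℂ (Matrix.toEuclideanLin (pairProjector ψ i j) ξ) η =
      inner ℂ ξ (Matrix.toEuclideanLin (pairProjector ψ i j) η) := by
    intro ξ η
    rw [← LinearMap.adjoint_inner_right, ← Matrix.toEuclideanLin_conjTranspose_eq_adjoint, hherm]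
  have := inner_self_eq_norm_sq_to_K (𝕜 := ℂ) (Matrix.toEuclideanLin (pairProjector ψ i j) ξ)
  rwa [hadj, hidem] at this

theorem toEuclideanLin_pairProjector_eq_zero_iff (hψ : ‖ψ‖ = 1) {i j : Fin n} (h : i ≠ j)
    (ξ : Chain n) : Matrix.toEuclideanLin (pairProjector ψ i j) ξ = 0 ↔
      swapOp i j (siteOp i (tMatrix ψ) ξ) = siteOp i (tMatrix ψ) ξ := by
  have hcon : Matrix.toEuclideanLin (pairProjector ψ i j) ξ = 0 ↔
      ∀ x, contraction ψ i j ξ x = 0 := by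
    constructor
    · intro h0 x
      have hne : ∃ a b, ψ (a, b) ≠ 0 := by
        by_contra hcon
        push Not at hcon
        have := sum_star_mul_self hψ
        simp [hcon] at this
      obtain ⟨a, b, hab⟩ := hne
      have h1 := congrArg
        (fun ζ : Chain n => ζ (Function.update (Function.update x i a) j b)) h0
      simp only [pairProjector_apply h, PiLp.zero_apply] at h1
      rw [contraction_congr (y := x) (fun k hi hj => by simp [hi, hj])] at h1
      refine (mul_eq_zero.1 h1).resolve_left ?_
      simpa [h] using hab
    · intro h0
      ext x
      rw [pairProjector_apply h, h0, mul_zero]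
      rfl
  -- The two-qubit antisymmetric space is one-dimensional, so the antisymmetric part of `T_i ξ` is a
  -- sign times the contraction with ψ. `tMatrix` is arranged to make this hold.
  have hdiff : ∀ x, siteOp i (tMatrix ψ) ξ x - swapOp i j (siteOp i (tMatrix ψ) ξ) x =
      (if x i = x j then 0 else if x i = 0 then 1 else -1) * contraction ψ i j ξ x := by
    intro x
    obtain ⟨φ, hφ⟩ : ∃ φ : Fin 2 → Fin 2 → ℂ, ∀ a b,
        ξ (Function.update (Function.update x i a) j b) = φ a b := ⟨_, fun _ _ => rfl⟩
    have h1 : ∀ a, ξ (Function.update x i a) = φ a (x j) := fun a => by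
      rw [← hφ, ← Function.update_of_ne h.symm a x, Function.update_eq_self]
    have h4 : ∀ a b c, ξ (Function.update (Function.update (Function.update x i a) j b) i c)
        = φ c b := fun a b c => by
      rw [← hφ, Function.update_comm h.symm, Function.update_idem]
    simp only [swapOp_apply, siteOp_apply, comp_swap_eq h, Fin.sum_univ_two, contraction,
      h1, h4, Function.update_self, Function.update_of_ne h, hφ]
    generalize x i = a
    generalize x j = b
    fin_cases a <;> fin_cases b <;> simp [tMatrix] <;> ring
  rw [hcon]
  constructor
  · intro h0
    ext x
    have := hdiff x
    rw [h0, mul_zero] at this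
    exact (sub_eq_zero.1 this).symm
  · intro h0 x
    have := hdiff (Function.update (Function.update x i 0) j 1)
    rw [h0, sub_self, contraction_congr (y := x) (fun k hi hj => by simp [hi, hj])] at this
    simpa [h] using this.symm

theorem blockHamiltonian_apply (S : Finset (Fin n)) (ξ : Chain n) :
    blockHamiltonian ψ S ξ = ∑ i : Fin n, ∑ j : Fin n,
      if i ∈ S ∧ j ∈ S ∧ (i : ℕ) + 1 = (j : ℕ) then
        Matrix.toEuclideanLin (pairProjector ψ i j) ξ else 0 := by
  simp only [blockHamiltonian, map_sum, LinearMap.sum_apply]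
  refine Finset.sum_congr rfl fun i _ => Finset.sum_congr rfl fun j _ => ?_
  split_ifs
  · rfl
  · simp

theorem inner_blockHamiltonian (hψ : ‖ψ‖ = 1) (S : Finset (Fin n)) (ξ : Chain n) :
    inner ℂ ξ (blockHamiltonian ψ S ξ) = ((∑ i : Fin n, ∑ j : Fin n,
      if i ∈ S ∧ j ∈ S ∧ (i : ℕ) + 1 = (j : ℕ) then
        ‖Matrix.toEuclideanLin (pairProjector ψ i j) ξ‖ ^ 2 else 0 : ℝ) : ℂ) := by
  rw [blockHamiltonian_apply, inner_sum]
  push_cast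
  refine Finset.sum_congr rfl fun i _ => ?_
  rw [inner_sum]
  refine Finset.sum_congr rfl fun j _ => ?_
  split_ifs with h
  · rw [inner_pairProjector hψ]
    · push_cast; rfl
    · rintro rfl; omega
  · simp

/-- The energy is a sum of squared norms, so zero energy means that every bond term vanishes. -/
theorem mem_ker_blockHamiltonian_iff (hψ : ‖ψ‖ = 1) (S : Finset (Fin n)) (ξ : Chain n) :
    blockHamiltonian ψ S ξ = 0 ↔ ∀ i j : Fin n, i ∈ S → j ∈ S → (i : ℕ) + 1 = j →
      swapOp i j (siteOp i (tMatrix ψ) ξ) = siteOp i (tMatrix ψ) ξ := by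
  have hne : ∀ {i j : Fin n}, (i : ℕ) + 1 = j → i ≠ j := by
    rintro i j h rfl
    omega
  constructor
  · intro h i j hi hj hij
    have h1 := inner_blockHamiltonian hψ S ξ
    rw [h, inner_zero_right, eq_comm, Complex.ofReal_eq_zero,
      Finset.sum_eq_zero_iff_of_nonneg (fun i _ => Finset.sum_nonneg fun j _ => by
        split_ifs <;> positivity)] at h1
    have h2 := h1 i (Finset.mem_univ i)
    rw [Finset.sum_eq_zero_iff_of_nonneg (fun j _ => by split_ifs <;> positivity)] at h2
    have h3 := h2 j (Finset.mem_univ j)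
    rw [if_pos ⟨hi, hj, hij⟩, pow_eq_zero_iff two_ne_zero, norm_eq_zero] at h3
    exact (toEuclideanLin_pairProjector_eq_zero_iff hψ (hne hij) ξ).1 h3
  · intro h
    rw [blockHamiltonian_apply]
    refine Finset.sum_eq_zero fun i _ => Finset.sum_eq_zero fun j _ => ?_
    split_ifs with hij
    · exact (toEuclideanLin_pairProjector_eq_zero_iff hψ (hne hij.2.2) ξ).2
        (h i j hij.1 hij.2.1 hij.2.2)
    · rfl

/-- The product state of copies of an eigenvector of `T` has zero energy. -/
theorem exists_ne_zero_blockHamiltonian_eq_zero (hψ : ‖ψ‖ = 1) (S : Finset (Fin n)) {μ : ℂ}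
    {u : EuclideanSpace ℂ (Fin 2)}
    (hu : Module.End.HasEigenvector (Matrix.toEuclideanLin (tMatrix ψ)) μ u) :
    ∃ ξ : Chain n, ξ ≠ 0 ∧ blockHamiltonian ψ S ξ = 0 := by
  obtain ⟨u0, u1⟩ := coords_of_hasEigenvector hu
  set Φ : Chain n := WithLp.toLp 2 fun x => ∏ k, u (x k) with hΦ
  have hΦx : ∀ x, Φ x = ∏ k, u (x k) := fun _ => rfl
  refine ⟨Φ, ?_, ?_⟩
  · intro h0
    obtain ⟨a, ha⟩ : ∃ a, u a ≠ 0 := by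
      by_contra hcon
      push Not at hcon
      exact hu.2 (by ext a; exact hcon a)
    have h1 := congrArg (fun ζ : Chain n => ζ fun _ => a) h0
    simp only [hΦx, PiLp.zero_apply, Finset.prod_const] at h1
    exact pow_ne_zero _ ha h1
  · rw [mem_ker_blockHamiltonian_iff hψ]
    intro i j _ _ hij
    have h1 : siteOp i (tMatrix ψ) Φ = μ • Φ := by
      ext x
      have h2 : ∀ b, Φ (Function.update x i b) = u b * ∏ k ∈ Finset.univ.erase i, u (x k) := by
        intro b
        rw [hΦx, ← Finset.mul_prod_erase _ _ (Finset.mem_univ i), Function.update_self]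
        congr 1
        refine Finset.prod_congr rfl fun k hk => ?_
        rw [Function.update_of_ne (Finset.ne_of_mem_erase hk)]
      have h3 := h2 (x i)
      rw [Function.update_eq_self] at h3
      rw [siteOp_apply, Fin.sum_univ_two, h2, h2, PiLp.smul_apply, h3, smul_eq_mul]
      have h4 : tMatrix ψ (x i) 0 * u 0 + tMatrix ψ (x i) 1 * u 1 = μ * u (x i) := by
        generalize x i = a
        fin_cases a
        · exact u0
        · exact u1
      linear_combination (∏ k ∈ Finset.univ.erase i, u (x k)) * h4
    have h2 : swapOp i j Φ = Φ := by
      ext x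
      rw [swapOp_apply, hΦx, hΦx]
      exact Equiv.prod_comp (Equiv.swap i j) fun k => u (x k)
    rw [h1, map_smul, h2]

theorem groundEnergy_blockHamiltonian (hψ : ‖ψ‖ = 1) (S : Finset (Fin n)) {μ : ℂ}
    {u : EuclideanSpace ℂ (Fin 2)}
    (hu : Module.End.HasEigenvector (Matrix.toEuclideanLin (tMatrix ψ)) μ u) :
    groundEnergy (blockHamiltonian ψ S) = 0 := by
  refine IsLeast.csInf_eq ⟨?_, ?_⟩
  · obtain ⟨ξ, hξ, hξ'⟩ := exists_ne_zero_blockHamiltonian_eq_zero hψ S hu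
    refine Module.End.hasEigenvalue_of_hasEigenvector (x := ξ) ⟨?_, hξ⟩
    rw [Module.End.mem_eigenspace_iff, hξ', Complex.ofReal_zero, zero_smul]
  · intro E hE
    obtain ⟨ξ, hξ⟩ := Module.End.HasEigenvalue.exists_hasEigenvector hE
    have h1 := inner_blockHamiltonian hψ S ξ
    rw [hξ.apply_eq_smul, inner_smul_right, inner_self_eq_norm_sq_to_K] at h1
    have h2 : E * ‖ξ‖ ^ 2 = ∑ i : Fin n, ∑ j : Fin n,
        if i ∈ S ∧ j ∈ S ∧ (i : ℕ) + 1 = (j : ℕ) then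
          ‖Matrix.toEuclideanLin (pairProjector ψ i j) ξ‖ ^ 2 else 0 := by
      refine Complex.ofReal_injective ?_
      rw [← h1]
      push_cast
      rfl
    have h3 : 0 ≤ E * ‖ξ‖ ^ 2 := by
      rw [h2]
      exact Finset.sum_nonneg fun i _ => Finset.sum_nonneg fun j _ => by
        split_ifs <;> positivity
    exact nonneg_of_mul_nonneg_left h3 (pow_pos (norm_pos_iff.2 hξ.2) 2)

/-- The half-open block ending at `q + 1` has q as its last site, which matches the bonds below q.
`Fin.ofNat` does not wrap around on these positions. -/
theorem groundSpace_block (hψ : ‖ψ‖ = 1) [NeZero n] {μ : ℂ} {u : EuclideanSpace ℂ (Fin 2)}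
    (hu : Module.End.HasEigenvector (Matrix.toEuclideanLin (tMatrix ψ)) μ u) {p q : ℕ}
    (hq : q < n) :
    groundSpace (blockHamiltonian ψ (block n p (q + 1))) =
      chainSpace (tMatrix ψ) (Fin.ofNat n) p q := by
  ext ξ
  rw [groundSpace, groundEnergy_blockHamiltonian hψ _ hu, Complex.ofReal_zero,
    Module.End.mem_eigenspace_iff, zero_smul, mem_ker_blockHamiltonian_iff hψ, mem_chainSpace]
  have hval : ∀ {i : ℕ}, i < n → ((Fin.ofNat n i : Fin n) : ℕ) = i := fun h =>
    Nat.mod_eq_of_lt h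
  constructor
  · intro h i h1 h2
    refine h _ _ ?_ ?_ ?_
    · simp only [block, Finset.mem_filter, Finset.mem_univ, true_and]
      rw [hval (by omega)]
      omega
    · simp only [block, Finset.mem_filter, Finset.mem_univ, true_and]
      rw [hval (by omega)]
      omega
    · rw [hval (by omega), hval (by omega)]
  · intro h i j hi hj hij
    simp only [block, Finset.mem_filter, Finset.mem_univ, true_and] at hi hj
    have h1 := h i hi.1 (by omega)
    rw [hij] at h1
    simpa only [Fin.ofNat_val_eq_self] using h1

end GroundSpace

/-! ### The bound in terms of the block size -/

section Main

theorem sqrt_pow_le_rpow {x : ℝ} (h0 : 0 ≤ x) (h1 : x ≤ 1) {r : ℕ} (hr : 0 < r) :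
    √x ^ r ≤ x ^ ((r : ℝ) / 8) := by
  rcases h0.eq_or_lt with rfl | h0
  · rw [Real.sqrt_zero, zero_pow hr.ne']
    exact Real.rpow_nonneg le_rfl _
  · rw [Real.sqrt_eq_rpow, ← Real.rpow_natCast, ← Real.rpow_mul h0.le]
    refine Real.rpow_le_rpow_of_exponent_ge h0 h1 ?_
    have : (0 : ℝ) ≤ r := Nat.cast_nonneg r
    linarith

theorem sqrt_sqrt_pow_le_rpow {x : ℝ} (h0 : 0 < x) (h1 : x ≤ 1) (r : ℕ) :
    √(√x) ^ r ≤ x ^ ((r : ℝ) / 8) := by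
  rw [Real.sqrt_eq_rpow, Real.sqrt_eq_rpow, ← Real.rpow_mul h0.le, ← Real.rpow_natCast,
    ← Real.rpow_mul h0.le]
  refine Real.rpow_le_rpow_of_exponent_ge h0 h1 ?_
  have : (0 : ℝ) ≤ r := Nat.cast_nonneg r
  linarith

theorem norm_groundProjector_le {n : ℕ} (ψ : TwoQubit) (S : Finset (Fin n)) :
    ‖groundProjector ψ S‖ ≤ 1 :=
  Submodule.starProjection_norm_le _

theorem projectorDefect_le_two (ψ : TwoQubit) (a r b : ℕ) : projectorDefect ψ a r b ≤ 2 := by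
  refine (norm_sub_le _ _).trans ?_
  have h1 := norm_groundProjector_le ψ (block (a + r + b) 0 (a + r + b))
  have h2 := norm_mul_le (groundProjector ψ (block (a + r + b) 0 (a + r)))
    (groundProjector ψ (block (a + r + b) a (a + r + b)))
  have h3 := mul_le_one₀ (norm_groundProjector_le ψ (block (a + r + b) 0 (a + r)))
    (norm_nonneg _) (norm_groundProjector_le ψ (block (a + r + b) a (a + r + b)))
  linarith

/-- The defect decays exponentially in the size `r` of the middle block. -/
theorem projectorDefect_le {ψ : TwoQubit} (hψ : ‖ψ‖ = 1) {μ ν : ℂ}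
    {u v : EuclideanSpace ℂ (Fin 2)}
    (hu : Module.End.HasEigenvector (Matrix.toEuclideanLin (tMatrix ψ)) μ u)
    (hv : Module.End.HasEigenvector (Matrix.toEuclideanLin (tMatrix ψ)) ν v)
    (hμν : ‖μ‖ < ‖ν‖) (hu1 : ‖u‖ = 1) (hv1 : ‖v‖ = 1) (a b : ℕ) {r : ℕ} (hr : 0 < r) :
    projectorDefect ψ a r b ≤
      overlapConst (tMatrix ψ) / (1 - ‖μ‖ / ‖ν‖) / (1 - √(√(‖μ‖ / ‖ν‖))) /
        (1 - √(√(‖μ‖ / ‖ν‖))) * √(√(‖μ‖ / ‖ν‖)) ^ r +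
        2 / (1 - √‖inner ℂ u v‖) / (1 - √‖inner ℂ u v‖) * √‖inner ℂ u v‖ ^ r := by
  have h := isSpectralPair_of_hasEigenvector hu hv hμν hu1 hv1
  have hn : NeZero (a + r + b) := ⟨by omega⟩
  have hs : Set.InjOn (Fin.ofNat (a + r + b)) (Set.Iic (a + r + b - 1)) := by
    intro i hi j hj hij
    rw [Set.mem_Iic] at hi hj
    have := congrArg Fin.val hij
    simp only [Fin.val_ofNat] at this
    rwa [Nat.mod_eq_of_lt (by omega), Nat.mod_eq_of_lt (by omega)] at this
  obtain ⟨q, hq⟩ : ∃ q, a + r = q + 1 := ⟨a + r - 1, by omega⟩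
  have hqb : a + r + b = q + b + 1 := by omega
  have h1 : groundProjector ψ (block (a + r + b) 0 (a + r + b)) =
      chainProj (tMatrix ψ) (Fin.ofNat (a + r + b)) 0 (q + b) := by
    have := groundSpace_block (n := a + r + b) hψ hu (p := 0) (q := q + b) (by omega)
    rw [groundProjector, chainProj]
    simp only [← this, ← hqb]
  have h2 : groundProjector ψ (block (a + r + b) 0 (a + r)) =
      chainProj (tMatrix ψ) (Fin.ofNat (a + r + b)) 0 q := by
    have := groundSpace_block (n := a + r + b) hψ hu (p := 0) (q := q) (by omega)
    rw [groundProjector, chainProj]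
    simp only [← this, ← hq]
  have h3 : groundProjector ψ (block (a + r + b) a (a + r + b)) =
      chainProj (tMatrix ψ) (Fin.ofNat (a + r + b)) (0 + a) (q + b) := by
    have := groundSpace_block (n := a + r + b) hψ hu (p := a) (q := q + b) (by omega)
    rw [groundProjector, chainProj, zero_add]
    simp only [← this, ← hqb]
  rw [projectorDefect, h1, h2, h3]
  exact norm_chainProj_sub_mul_le hs h (by omega) hr (by omega)

end Main
end

theorem theorem2 (ψ : TwoQubit) (hψ : ‖ψ‖ = 1) :
    ∃ K₁ K₂ : ℝ, ∀ (μ₁ μ₂ : ℂ) (u v : EuclideanSpace ℂ (Fin 2)),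
      Module.End.HasEigenvector (Matrix.toEuclideanLin (tMatrix ψ)) μ₁ u →
      Module.End.HasEigenvector (Matrix.toEuclideanLin (tMatrix ψ)) μ₂ v →
      ‖μ₁‖ < ‖μ₂‖ → ‖u‖ = 1 → ‖v‖ = 1 →
      ∀ a r b : ℕ,
        (μ₁ ≠ 0 →
          projectorDefect ψ a r b ≤
            K₁ * ((r : ℝ) ^ (1 / 2 : ℝ) * ‖μ₂ / μ₁‖ ^ (-(r : ℝ) / 8)) +
              K₂ * ‖inner ℂ u v‖ ^ ((r : ℝ) / 8)) ∧
        (μ₁ = 0 →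
          projectorDefect ψ a r b ≤ K₂ * ‖inner ℂ u v‖ ^ ((r : ℝ) / 8)) := by
  -- The constants must be fixed before the eigendata are given. They are built from one choice, and
  -- `eq_of_hasEigenvector` shows that any other choice has the same eigenvalues and overlap
  -- modulus.
  by_cases hex : ∃ (μ ν : ℂ) (u v : EuclideanSpace ℂ (Fin 2)),
      Module.End.HasEigenvector (Matrix.toEuclideanLin (tMatrix ψ)) μ u ∧
      Module.End.HasEigenvector (Matrix.toEuclideanLin (tMatrix ψ)) ν v ∧
      ‖μ‖ < ‖ν‖ ∧ ‖u‖ = 1 ∧ ‖v‖ = 1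
  swap
  · exact ⟨0, 0, fun μ₁ μ₂ u v hu hv h1 h2 h3 => absurd ⟨μ₁, μ₂, u, v, hu, hv, h1, h2, h3⟩ hex⟩
  obtain ⟨μ, ν, u₀, v₀, hu₀, hv₀, hμν, hu₀1, hv₀1⟩ := hex
  set ρ := ‖μ‖ / ‖ν‖ with hρ
  set c := ‖inner ℂ u₀ v₀‖ with hc
  have h := isSpectralPair_of_hasEigenvector hu₀ hv₀ hμν hu₀1 hv₀1
  have hρ0 : 0 ≤ ρ := h.ratio_nonneg
  have hρ1 : ρ < 1 := h.ratio_lt_one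
  have hc0 : 0 ≤ c := h.overlap_nonneg
  have hc1 : c < 1 := h.overlap_lt_one
  have hθ : √(√ρ) < 1 := by
    rw [Real.sqrt_lt' one_pos, one_pow, Real.sqrt_lt' one_pos, one_pow]
    exact hρ1
  have hφ : √c < 1 := by
    rw [Real.sqrt_lt' one_pos, one_pow]
    exact hc1
  have hρ1' : 0 < 1 - ρ := by linarith
  have hθ' : 0 < 1 - √(√ρ) := by linarith
  have hφ' : 0 < 1 - √c := by linarith
  have hC := overlapConst_nonneg (tMatrix ψ)
  set A := overlapConst (tMatrix ψ) / (1 - ρ) / (1 - √(√ρ)) / (1 - √(√ρ)) with hA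
  set B := 2 / (1 - √c) / (1 - √c) with hB
  have hA0 : 0 ≤ A := by positivity
  have hB0 : 0 ≤ B := by positivity
  -- The extra 2 covers r = 0, where the defect is at most 2 and the power of c is 1.
  refine ⟨A, B + 2, fun μ₁ μ₂ u v hu hv h12 hu1 hv1 a r b => ?_⟩
  obtain ⟨rfl, rfl, hcc⟩ := eq_of_hasEigenvector hu₀ hv₀ hμν hu₀1 hv₀1 hu hv h12 hu1 hv1
  rw [hcc, ← hc]
  rcases Nat.eq_zero_or_pos r with rfl | hr
  · have h2 := projectorDefect_le_two ψ a 0 b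
    norm_num
    constructor <;> intro <;> linarith
  have hle := projectorDefect_le hψ hu₀ hv₀ hμν hu₀1 hv₀1 a b hr
  rw [← hρ, ← hc, ← hA, ← hB] at hle
  have hcr : B * √c ^ r ≤ (B + 2) * c ^ ((r : ℝ) / 8) := by
    have := sqrt_pow_le_rpow hc0 hc1.le hr
    gcongr
    linarith
  constructor
  · intro hμ
    have hμ0 : 0 < ‖μ₁‖ := norm_pos_iff.2 hμ
    have hν0 : 0 < ‖μ₂‖ := hμ0.trans h12
    have h1 : ‖μ₂ / μ₁‖ ^ (-(r : ℝ) / 8) = ρ ^ ((r : ℝ) / 8) := by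
      rw [norm_div, neg_div, Real.rpow_neg (by positivity), ← Real.inv_rpow (by positivity),
        inv_div]
    -- The factor r^(1/2) is at least 1 for r ≥ 1, so it only weakens the bound already proved.
    have h2 : (1 : ℝ) ≤ (r : ℝ) ^ (1 / 2 : ℝ) :=
      Real.one_le_rpow (by exact_mod_cast hr) (by norm_num)
    have h3 := sqrt_sqrt_pow_le_rpow (div_pos hμ0 hν0) hρ1.le r
    have h4 : √(√ρ) ^ r ≤ (r : ℝ) ^ (1 / 2 : ℝ) * ρ ^ ((r : ℝ) / 8) :=
      h3.trans (le_mul_of_one_le_left (Real.rpow_nonneg hρ0 _) h2)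
    rw [h1]
    exact hle.trans (add_le_add (mul_le_mul_of_nonneg_left h4 hA0) hcr)
  · rintro rfl
    have h1 : ρ = 0 := by rw [hρ, norm_zero, zero_div]
    rw [h1, Real.sqrt_zero, Real.sqrt_zero, zero_pow hr.ne', mul_zero, zero_add] at hle
    exact hle.trans hcr
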